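/- Let $(M,g)$ be a smooth compact Riemannian manifold (without boundary) of dimension $n\ge 6$, with Ricci tensor $Rc$, scalar curvature $R$ and Riemannian volume measure $\mu$. Put $$J=\frac{R}{2(n-1)},\qquad A=\frac{1}{n-2}\,(Rc-Jg),\qquad \sigma_2(A)=\tfrac12\left(J^2-|A|^2\right),\qquad Q=-\Delta J-2|A|^2+\tfrac n2J^2,$$ and let $$P\varphi=\Delta^2\varphi+\operatorname{div}\bigl(4A(\nabla\varphi,e_i)e_i-(n-2)J\nabla\varphi\bigr)+\tfrac{n-4}{2}Q\varphi$$ be the Paneitz operator, where $e_1,\dots,e_n$ is a local orthonormal frame and repeated indices are summed. Let $0\le\lambda\le4$ and suppose that $Q-\lambda\sigma_2(A)>0$ and $J>0$ everywhere on $M$. Then the operator $$H\varphi=P\varphi-\tfrac{n+4}{2}Q\varphi+\lambda\bigl(J\Delta\varphi-\langle A,D^2\varphi\rangle+4\sigma_2(A)\varphi\bigr)+\tfrac{n+4}{2}\bigl(Q-\lambda\sigma_2(A)\bigr)\varphi$$ is positive definite; that is, it is symmetric, $\int_M H\varphi\cdot\psi\,d\mu=\int_M\varphi\cdot H\psi\,d\mu$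 for all $\varphi,\psi\in C^\infty(M)$, and its first eigenvalue is positive: there is a constant $c>0$ such that $$\int_M H\varphi\cdot\varphi\,d\mu\ \ge\ c\int_M\varphi^2\,d\mu\qquad\text{for all }\varphi\in C^\infty(M).$$ -/

import Mathlib

open MeasureTheory
open scoped Manifold ContDiff Matrix

noncomputable section

namespace PaneitzH

/-! ### Riemannian geometry in coordinates

`G : E n → Matrix (Fin n) (Fin n) ℝ` is the matrix `(g_ij)` of a metric in a coordinate system.
Upper indices of the inverse metric are written `(G y)⁻¹ i j`. -/

/-- The coordinate space `ℝⁿ`. -/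
abbrev E (n : ℕ) : Type := EuclideanSpace ℝ (Fin n)

variable {n : ℕ}

/-- The coordinate partial derivative `∂_i f`. -/
def pd (i : Fin n) (f : E n → ℝ) (y : E n) : ℝ :=
  fderiv ℝ f y (EuclideanSpace.single i 1)

/-- The Christoffel symbol `Γ^k_{ij}` of the Levi-Civita connection. -/
def christoffel (G : E n → Matrix (Fin n) (Fin n) ℝ) (k i j : Fin n) (y : E n) : ℝ :=
  (1 / 2) * ∑ l, (G y)⁻¹ k l *
    (pd i (fun z => G z j l) y + pd j (fun z => G z i l) y - pd l (fun z => G z i j) y)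

/-- The Ricci tensor
`Rc_{ij} = ∂_k Γ^k_{ij} - ∂_j Γ^k_{ik} + Γ^k_{kl} Γ^l_{ij} - Γ^k_{jl} Γ^l_{ik}`
(with this sign it is positive on round spheres). -/
def ricci (G : E n → Matrix (Fin n) (Fin n) ℝ) (i j : Fin n) (y : E n) : ℝ :=
  ∑ k, (pd k (christoffel G k i j) y - pd j (christoffel G k i k) y) +
    ∑ k, ∑ l, (christoffel G k k l y * christoffel G l i j y -
      christoffel G k j l y * christoffel G l i k y)

/-- The scalar curvature `R = g^{ij} Rc_{ij}`. -/
def scalarCurv (G : E n → Matrix (Fin n) (Fin n) ℝ) (y : E n) : ℝ :=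
  ∑ i, ∑ j, (G y)⁻¹ i j * ricci G i j y

/-- `J = R / (2 (n - 1))`. -/
def locJ (G : E n → Matrix (Fin n) (Fin n) ℝ) (y : E n) : ℝ :=
  scalarCurv G y / (2 * ((n : ℝ) - 1))

/-- The Schouten tensor `A = (Rc - J g) / (n - 2)`, lower indices. -/
def schouten (G : E n → Matrix (Fin n) (Fin n) ℝ) (i j : Fin n) (y : E n) : ℝ :=
  (1 / ((n : ℝ) - 2)) * (ricci G i j y - locJ G y * G y i j)

/-- The full contraction `g^{ik} g^{jl} S_{ij} T_{kl}` of two covariant 2-tensors at `y`. -/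
def contract (G : E n → Matrix (Fin n) (Fin n) ℝ) (S T : Fin n → Fin n → ℝ) (y : E n) : ℝ :=
  ∑ i, ∑ j, ∑ k, ∑ l, (G y)⁻¹ i k * (G y)⁻¹ j l * S i j * T k l

/-- `σ₂(A) = (J² - |A|²) / 2`. -/
def locSigmaTwo (G : E n → Matrix (Fin n) (Fin n) ℝ) (y : E n) : ℝ :=
  (1 / 2) * (locJ G y ^ 2 -
    contract G (fun i j => schouten G i j y) (fun i j => schouten G i j y) y)

/-- The Hessian `(D²f)_{ij} = ∂_i ∂_j f - Γ^k_{ij} ∂_k f`. -/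
def hess (G : E n → Matrix (Fin n) (Fin n) ℝ) (f : E n → ℝ) (i j : Fin n) (y : E n) : ℝ :=
  pd i (pd j f) y - ∑ k, christoffel G k i j y * pd k f y

/-- The Laplace–Beltrami operator `Δf = g^{ij} (D²f)_{ij}`. -/
def lap (G : E n → Matrix (Fin n) (Fin n) ℝ) (f : E n → ℝ) (y : E n) : ℝ :=
  ∑ i, ∑ j, (G y)⁻¹ i j * hess G f i j y

/-- The gradient `(∇f)^i = g^{ij} ∂_j f`. -/
def grad (G : E n → Matrix (Fin n) (Fin n) ℝ) (f : E n → ℝ) (i : Fin n) (y : E n) : ℝ :=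
  ∑ j, (G y)⁻¹ i j * pd j f y

/-- The divergence `div X = ∂_i X^i + Γ^i_{ij} X^j`. -/
def divg (G : E n → Matrix (Fin n) (Fin n) ℝ) (X : Fin n → E n → ℝ) (y : E n) : ℝ :=
  ∑ i, pd i (X i) y + ∑ i, ∑ j, christoffel G i i j y * X j y

/-- The `Q` curvature `Q = -ΔJ - 2|A|² + (n/2) J²`. -/
def locQ (G : E n → Matrix (Fin n) (Fin n) ℝ) (y : E n) : ℝ :=
  -lap G (locJ G) y
    - 2 * contract G (fun i j => schouten G i j y) (fun i j => schouten G i j y) y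
    + ((n : ℝ) / 2) * locJ G y ^ 2

/-- The vector field `A(∇f, e_a) e_a` (`e_a` an orthonormal frame); in coordinates, its `i`-th
component is `g^{ij} A_{jk} (∇f)^k`. -/
def schoutenGrad (G : E n → Matrix (Fin n) (Fin n) ℝ) (f : E n → ℝ) (i : Fin n) (y : E n) : ℝ :=
  ∑ j, ∑ k, (G y)⁻¹ i j * schouten G j k y * grad G f k y

/-- The Paneitz operator
`Pf = Δ²f + div (4 A(∇f, e_a) e_a - (n - 2) J ∇f) + ((n - 4)/2) Q f`. -/
def locP (G : E n → Matrix (Fin n) (Fin n) ℝ) (f : E n → ℝ) (y : E n) : ℝ :=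
  lap G (lap G f) y
    + divg G (fun i z => 4 * schoutenGrad G f i z - ((n : ℝ) - 2) * locJ G z * grad G f i z) y
    + (((n : ℝ) - 4) / 2) * locQ G y * f y

/-- The operator `Hf = Pf - ((n+4)/2) Q f + λ (J Δf - ⟨A, D²f⟩ + 4 σ₂(A) f)
+ ((n+4)/2) (Q - λ σ₂(A)) f`. -/
def locH (G : E n → Matrix (Fin n) (Fin n) ℝ) (lam : ℝ) (f : E n → ℝ) (y : E n) : ℝ :=
  locP G f y - (((n : ℝ) + 4) / 2) * locQ G y * f y
    + lam * (locJ G y * lap G f y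
        - contract G (fun i j => schouten G i j y) (fun i j => hess G f i j y) y
        + 4 * locSigmaTwo G y * f y)
    + (((n : ℝ) + 4) / 2) * (locQ G y - lam * locSigmaTwo G y) * f y

/-! ### Riemannian manifolds -/

variable {M : Type*} [TopologicalSpace M] [ChartedSpace (E n) M] [IsManifold (𝓡 n) ∞ M]

/-- Smooth Riemannian metrics on `M`. -/
abbrev SmoothMetric (n : ℕ) (M : Type*) [TopologicalSpace M] [ChartedSpace (E n) M]
    [IsManifold (𝓡 n) ∞ M] : Type _ :=
  Bundle.ContMDiffRiemannianMetric (𝓡 n) ∞ (E n) (fun x : M => TangentSpace (𝓡 n) x)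

/-- The coordinate vector field `∂_i` of the preferred chart at `c`, at the point with
coordinates `y`. -/
def coordVec (c : M) (i : Fin n) (y : E n) :
    TangentSpace (𝓡 n) ((extChartAt (𝓡 n) c).symm y) :=
  mfderiv 𝓘(ℝ, E n) (𝓡 n) (extChartAt (𝓡 n) c).symm y (EuclideanSpace.single i (1 : ℝ) : E n)

/-- The matrix `g_ij = g(∂_i, ∂_j)` of the metric in the preferred chart at `c`, as a function of
the coordinates. -/
def metricInChart (g : SmoothMetric n M) (c : M) (y : E n) : Matrix (Fin n) (Fin n) ℝ :=
  Matrix.of fun i j =>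
    g.inner ((extChartAt (𝓡 n) c).symm y) (coordVec c i y) (coordVec c j y)

/-! The following scalars are independent of the coordinates in which they are computed; at the
point `x` the preferred chart at `x` is used. -/

/-- `J = R / (2 (n - 1))` as a function on `M`. -/
def J (g : SmoothMetric n M) (x : M) : ℝ :=
  locJ (metricInChart g x) (extChartAt (𝓡 n) x x)

/-- `σ₂(A)` as a function on `M`. -/
def sigmaTwo (g : SmoothMetric n M) (x : M) : ℝ :=
  locSigmaTwo (metricInChart g x) (extChartAt (𝓡 n) x x)

/-- The `Q` curvature as a function on `M`. -/
def Q (g : SmoothMetric n M) (x : M) : ℝ :=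
  locQ (metricInChart g x) (extChartAt (𝓡 n) x x)

/-- The fourth-order operator `H` on functions on `M`. -/
def H (g : SmoothMetric n M) (lam : ℝ) (f : M → ℝ) (x : M) : ℝ :=
  locH (metricInChart g x) lam (f ∘ (extChartAt (𝓡 n) x).symm) (extChartAt (𝓡 n) x x)

/-- The coordinate volume `√(det g_ij) dy¹ ⋯ dyⁿ` of the preferred chart at `c`, transported to
the domain of that chart and extended by zero to `M`. -/
def chartVolume [MeasurableSpace M] (g : SmoothMetric n M) (c : M) : Measure M :=
  (((volume : Measure (E n)).restrict (extChartAt (𝓡 n) c).target).withDensity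
    (fun y => ENNReal.ofReal (Real.sqrt (metricInChart g c y).det))).map (extChartAt (𝓡 n) c).symm

/-- The Riemannian volume measure `μ` of `g`: the least measure on `M` that dominates the
coordinate volume of every chart. The coordinate volumes agree on overlaps of charts, so the
restriction of `μ` to each chart domain is the coordinate volume. -/
def vol [MeasurableSpace M] (g : SmoothMetric n M) : Measure M :=
  ⨆ c : M, chartVolume g c

/-- A linear differential operator `T` on a closed Riemannian manifold is positive definite if it
is symmetric in `L²` and its first eigenvalue, the infimum of `∫ Tφ · φ / ∫ φ²`, is positive. -/
def IsPositiveDefinite [MeasurableSpace M] (g : SmoothMetric n M) (T : (M → ℝ) → M → ℝ) : Prop :=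
  (∀ φ ψ : M → ℝ, ContMDiff (𝓡 n) 𝓘(ℝ, ℝ) ∞ φ → ContMDiff (𝓡 n) 𝓘(ℝ, ℝ) ∞ ψ →
    ∫ x, T φ x * ψ x ∂(vol g) = ∫ x, φ x * T ψ x ∂(vol g)) ∧
  ∃ c : ℝ, 0 < c ∧ ∀ φ : M → ℝ, ContMDiff (𝓡 n) 𝓘(ℝ, ℝ) ∞ φ →
    c * ∫ x, φ x ^ 2 ∂(vol g) ≤ ∫ x, T φ x * φ x ∂(vol g)

end PaneitzH

end

/-! Write t = (4 - λ)/(n - 2). By the contracted second Bianchi identity div A = dJ, so JΔφ - ⟨A,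
D²φ⟩ = div(J∇φ - A∇φ), and the zeroth-order terms of H add up to (n - 4)/2 · (Q - λσ₂)φ. Hence Hφ =
Δ²φ + div((4 - λ)A∇φ - (n - 2 - λ)J∇φ) + (n - 4)/2 · (Q - λσ₂)φ. Integration by parts leaves the
term -(4 - λ)A(∇φ,∇φ), which has no sign. Since Rc = (n - 2)A + Jg, Bochner's formula ∫ (Δφ)² = ∫
|D²φ|² + Rc(∇φ,∇φ) removes it: ∫ Hφ·φ = ∫ (1 - t)(Δφ)² + t|D²φ|² + (t + n - 2 - λ)J|∇φ|² + (n - 4)/2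
· (Q - λσ₂)φ². For n ≥ 6 and 0 ≤ λ ≤ 4 one has 0 ≤ t ≤ 1 and n - 2 - λ ≥ 0, so the first three terms
are nonnegative, and (n - 4)/2 times the minimum of Q - λσ₂ bounds the first eigenvalue from below.
The polarised integrand is symmetric in its two arguments, which gives the symmetry of H.

The pointwise form of this argument is `IsMetricOn.locH_mul_eq`: Hf·h is the bilinear integrand
`locB` plus the divergence of `fluxField`. The tensor identities behind it (`divg_schoutenGrad`,
`divg_hessGrad`) are checked at the centre of coordinates in which the metric is Euclidean to first
order, and carried to arbitrary coordinates by the invariance of every operator under pullback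
(`IsPullback`). That invariance rests on the transformation law of the Christoffel symbols, which
comes from the Koszul formula.

It also makes quantities defined at x by the chart at x computable in any fixed chart. The
divergence theorem is then needed only for compactly supported fields in one chart, where √det g ·
div X is a Euclidean divergence; a partition of unity applied to the second argument gives
`integral_H_mul_eq`, from which both symmetry and the lower bound follow. -/

noncomputable section

namespace PaneitzH

section

variable {n : ℕ} {U : Set (E n)} {f h : E n → ℝ} {G : E n → Matrix (Fin n) (Fin n) ℝ} {y : E n}

/-! ### Calculus of partial derivatives -/

/-- The standard basis vector `e_i` of `ℝⁿ`. -/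
abbrev stdVec (i : Fin n) : E n := EuclideanSpace.single i (1 : ℝ)

theorem differentiableAt_of_contDiffOn {F : Type*} [NormedAddCommGroup F] [NormedSpace ℝ F]
    {f : E n → F} (hU : IsOpen U) (hf : ContDiffOn ℝ ∞ f U) (hy : y ∈ U) :
    DifferentiableAt ℝ f y :=
  (hf.contDiffAt (hU.mem_nhds hy)).differentiableAt (by simp)

theorem contDiffOn_fderiv {F : Type*} [NormedAddCommGroup F] [NormedSpace ℝ F]
    {f : E n → F} (hU : IsOpen U) (hf : ContDiffOn ℝ ∞ f U) : ContDiffOn ℝ ∞ (fderiv ℝ f) U :=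
  hf.fderiv_of_isOpen hU (by simp)

theorem contDiffOn_pd (hU : IsOpen U) (hf : ContDiffOn ℝ ∞ f U) (i : Fin n) :
    ContDiffOn ℝ ∞ (pd i f) U :=
  (contDiffOn_fderiv hU hf).clm_apply contDiffOn_const

theorem pd_congr (hU : IsOpen U) (hy : y ∈ U) (hfh : ∀ z ∈ U, f z = h z) (i : Fin n) :
    pd i f y = pd i h y := by
  have : f =ᶠ[nhds y] h := Filter.eventually_of_mem (hU.mem_nhds hy) hfh
  rw [pd, pd, this.fderiv_eq]

theorem pd_const (i : Fin n) (a : ℝ) : pd i (fun _ : E n => a) y = 0 := by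
  simp [pd]

theorem pd_add (hU : IsOpen U) (hf : ContDiffOn ℝ ∞ f U) (hh : ContDiffOn ℝ ∞ h U) (hy : y ∈ U)
    (i : Fin n) : pd i (fun z => f z + h z) y = pd i f y + pd i h y := by
  have hf' := differentiableAt_of_contDiffOn hU hf hy
  have hh' := differentiableAt_of_contDiffOn hU hh hy
  simp [pd, fderiv_fun_add hf' hh']

theorem pd_sub (hU : IsOpen U) (hf : ContDiffOn ℝ ∞ f U) (hh : ContDiffOn ℝ ∞ h U) (hy : y ∈ U)
    (i : Fin n) : pd i (fun z => f z - h z) y = pd i f y - pd i h y := by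
  have hf' := differentiableAt_of_contDiffOn hU hf hy
  have hh' := differentiableAt_of_contDiffOn hU hh hy
  simp [pd, fderiv_fun_sub hf' hh']

theorem pd_mul (hU : IsOpen U) (hf : ContDiffOn ℝ ∞ f U) (hh : ContDiffOn ℝ ∞ h U) (hy : y ∈ U)
    (i : Fin n) : pd i (fun z => f z * h z) y = pd i f y * h y + f y * pd i h y := by
  have hf' := differentiableAt_of_contDiffOn hU hf hy
  have hh' := differentiableAt_of_contDiffOn hU hh hy
  simp [pd, fderiv_fun_mul hf' hh']
  ring

theorem pd_const_mul (hU : IsOpen U) (hf : ContDiffOn ℝ ∞ f U) (hy : y ∈ U) (a : ℝ)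
    (i : Fin n) : pd i (fun z => a * f z) y = a * pd i f y := by
  rw [pd_mul hU contDiffOn_const hf hy, pd_const]; ring

theorem pd_sum {ι : Type*} (s : Finset ι) {F : ι → E n → ℝ} (hU : IsOpen U)
    (hF : ∀ k, ContDiffOn ℝ ∞ (F k) U) (hy : y ∈ U)
    (i : Fin n) : pd i (fun z => ∑ k ∈ s, F k z) y = ∑ k ∈ s, pd i (F k) y := by
  have hF' := fun k (_ : k ∈ s) => differentiableAt_of_contDiffOn hU (hF k) hy
  simp [pd, fderiv_fun_sum hF']

theorem pd_comm (hU : IsOpen U) (hf : ContDiffOn ℝ ∞ f U) (hy : y ∈ U) (i j : Fin n) :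
    pd i (pd j f) y = pd j (pd i f) y := by
  have hd := differentiableAt_of_contDiffOn hU (contDiffOn_fderiv hU hf) hy
  have hs : IsSymmSndFDerivAt ℝ f y :=
    (hf.contDiffAt (hU.mem_nhds hy)).isSymmSndFDerivAt
      (by rw [minSmoothness_of_isRCLikeNormedField]; exact ENat.LEInfty.out)
  have key : ∀ a b : Fin n, pd a (pd b f) y = fderiv ℝ (fderiv ℝ f) y (stdVec a) (stdVec b) := by
    intro a b
    change fderiv ℝ (fun z => fderiv ℝ f z (stdVec b)) y (stdVec a) = _
    rw [fderiv_clm_apply hd (by fun_prop)]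
    simp
  rw [key, key, hs.eq]

/-! ### Metrics on open subsets of `ℝⁿ` -/

/-- `G` is the matrix of a smooth Riemannian metric on the open set `U` of `ℝⁿ`. -/
structure IsMetricOn (G : E n → Matrix (Fin n) (Fin n) ℝ) (U : Set (E n)) : Prop where
  isOpen : IsOpen U
  smooth : ∀ i j, ContDiffOn ℝ ∞ (fun y => G y i j) U
  posDef : ∀ y ∈ U, (G y).PosDef

theorem contDiffOn_det {A : E n → Matrix (Fin n) (Fin n) ℝ}
    (hA : ∀ i j, ContDiffOn ℝ ∞ (fun y => A y i j) U) :
    ContDiffOn ℝ ∞ (fun y => (A y).det) U := by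
  simp only [Matrix.det_apply]
  exact ContDiffOn.sum fun σ _ => (contDiffOn_prod fun i _ => hA _ _).const_smul _

namespace IsMetricOn

theorem det_pos (hG : IsMetricOn G U) (hy : y ∈ U) : 0 < (G y).det := (hG.posDef y hy).det_pos

theorem isUnit_det (hG : IsMetricOn G U) (hy : y ∈ U) : IsUnit (G y).det :=
  (hG.det_pos hy).ne'.isUnit

theorem symm (hG : IsMetricOn G U) (hy : y ∈ U) (i j : Fin n) : G y i j = G y j i := by
  have := (hG.posDef y hy).isHermitian.apply j i
  simpa using this

theorem inv_symm (hG : IsMetricOn G U) (hy : y ∈ U) (i j : Fin n) :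
    (G y)⁻¹ i j = (G y)⁻¹ j i := by
  have := (hG.posDef y hy).isHermitian.inv.apply j i
  simpa using this

/-- By Cramer's rule an entry of the inverse is a quotient of two determinants, polynomial in the
entries of `G`, with positive denominator. -/
theorem inv_smooth (hG : IsMetricOn G U) (i j : Fin n) :
    ContDiffOn ℝ ∞ (fun y => (G y)⁻¹ i j) U := by
  have h1 : ∀ y, (G y)⁻¹ i j = (G y).det⁻¹ * ((G y).updateRow j (Pi.single i 1)).det := by
    intro y
    rw [Matrix.inv_def, Ring.inverse_eq_inv', Matrix.smul_apply, Matrix.adjugate_apply, smul_eq_mul]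
  simp only [h1]
  refine ((contDiffOn_det hG.smooth).inv fun y hy => (hG.det_pos hy).ne').mul
    (contDiffOn_det fun k l => ?_)
  by_cases hk : k = j
  · subst hk; simpa using contDiffOn_const
  · simpa [Matrix.updateRow_ne hk] using hG.smooth k l

theorem christoffel_smooth (hG : IsMetricOn G U) (k i j : Fin n) :
    ContDiffOn ℝ ∞ (christoffel G k i j) U := by
  have hp : ∀ a b c, ContDiffOn ℝ ∞ (pd a fun z => G z b c) U :=
    fun a b c => contDiffOn_pd hG.isOpen (hG.smooth b c) a
  exact contDiffOn_const.mul (ContDiffOn.sum fun l _ =>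
    (hG.inv_smooth k l).mul (((hp _ _ _).add (hp _ _ _)).sub (hp _ _ _)))

theorem ricci_smooth (hG : IsMetricOn G U) (i j : Fin n) :
    ContDiffOn ℝ ∞ (ricci G i j) U := by
  have hc := hG.christoffel_smooth
  have hp : ∀ a k i j, ContDiffOn ℝ ∞ (pd a (christoffel G k i j)) U :=
    fun a k i j => contDiffOn_pd hG.isOpen (hc k i j) a
  exact (ContDiffOn.sum fun k _ => (hp _ _ _ _).sub (hp _ _ _ _)).add
    (ContDiffOn.sum fun k _ => ContDiffOn.sum fun l _ =>
      ((hc _ _ _).mul (hc _ _ _)).sub ((hc _ _ _).mul (hc _ _ _)))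

theorem scalarCurv_smooth (hG : IsMetricOn G U) : ContDiffOn ℝ ∞ (scalarCurv G) U :=
  ContDiffOn.sum fun i _ => ContDiffOn.sum fun j _ => (hG.inv_smooth i j).mul (hG.ricci_smooth i j)

theorem locJ_smooth (hG : IsMetricOn G U) : ContDiffOn ℝ ∞ (locJ G) U :=
  hG.scalarCurv_smooth.div_const _

theorem schouten_smooth (hG : IsMetricOn G U) (i j : Fin n) :
    ContDiffOn ℝ ∞ (schouten G i j) U :=
  contDiffOn_const.mul ((hG.ricci_smooth i j).sub (hG.locJ_smooth.mul (hG.smooth i j)))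

theorem contract_smooth (hG : IsMetricOn G U) {S T : Fin n → Fin n → E n → ℝ}
    (hS : ∀ i j, ContDiffOn ℝ ∞ (S i j) U) (hT : ∀ i j, ContDiffOn ℝ ∞ (T i j) U) :
    ContDiffOn ℝ ∞ (fun y => contract G (fun i j => S i j y) (fun i j => T i j y) y) U :=
  ContDiffOn.sum fun i _ => ContDiffOn.sum fun j _ => ContDiffOn.sum fun k _ =>
    ContDiffOn.sum fun l _ =>
      (((hG.inv_smooth i k).mul (hG.inv_smooth j l)).mul (hS i j)).mul (hT k l)

theorem locSigmaTwo_smooth (hG : IsMetricOn G U) : ContDiffOn ℝ ∞ (locSigmaTwo G) U :=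
  contDiffOn_const.mul ((hG.locJ_smooth.pow 2).sub
    (hG.contract_smooth hG.schouten_smooth hG.schouten_smooth))

theorem hess_smooth (hG : IsMetricOn G U) (hf : ContDiffOn ℝ ∞ f U) (i j : Fin n) :
    ContDiffOn ℝ ∞ (hess G f i j) U :=
  (contDiffOn_pd hG.isOpen (contDiffOn_pd hG.isOpen hf j) i).sub
    (ContDiffOn.sum fun k _ => (hG.christoffel_smooth k i j).mul (contDiffOn_pd hG.isOpen hf k))

theorem lap_smooth (hG : IsMetricOn G U) (hf : ContDiffOn ℝ ∞ f U) :
    ContDiffOn ℝ ∞ (lap G f) U :=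
  ContDiffOn.sum fun i _ => ContDiffOn.sum fun j _ => (hG.inv_smooth i j).mul (hG.hess_smooth hf i j)

theorem grad_smooth (hG : IsMetricOn G U) (hf : ContDiffOn ℝ ∞ f U) (i : Fin n) :
    ContDiffOn ℝ ∞ (grad G f i) U :=
  ContDiffOn.sum fun j _ => (hG.inv_smooth i j).mul (contDiffOn_pd hG.isOpen hf j)

theorem divg_smooth (hG : IsMetricOn G U) {X : Fin n → E n → ℝ}
    (hX : ∀ i, ContDiffOn ℝ ∞ (X i) U) : ContDiffOn ℝ ∞ (divg G X) U :=
  (ContDiffOn.sum fun i _ => contDiffOn_pd hG.isOpen (hX i) i).add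
    (ContDiffOn.sum fun i _ => ContDiffOn.sum fun j _ => (hG.christoffel_smooth i i j).mul (hX j))

theorem locQ_smooth (hG : IsMetricOn G U) : ContDiffOn ℝ ∞ (locQ G) U :=
  ((hG.lap_smooth hG.locJ_smooth).neg.sub (contDiffOn_const.mul
    (hG.contract_smooth hG.schouten_smooth hG.schouten_smooth))).add
      (contDiffOn_const.mul (hG.locJ_smooth.pow 2))

theorem schoutenGrad_smooth (hG : IsMetricOn G U) (hf : ContDiffOn ℝ ∞ f U) (i : Fin n) :
    ContDiffOn ℝ ∞ (schoutenGrad G f i) U :=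
  ContDiffOn.sum fun j _ => ContDiffOn.sum fun k _ =>
    ((hG.inv_smooth i j).mul (hG.schouten_smooth j k)).mul (hG.grad_smooth hf k)

theorem locP_smooth (hG : IsMetricOn G U) (hf : ContDiffOn ℝ ∞ f U) :
    ContDiffOn ℝ ∞ (locP G f) U :=
  ((hG.lap_smooth (hG.lap_smooth hf)).add (hG.divg_smooth fun i =>
    (contDiffOn_const.mul (hG.schoutenGrad_smooth hf i)).sub
      ((contDiffOn_const.mul hG.locJ_smooth).mul (hG.grad_smooth hf i)))).add
    ((contDiffOn_const.mul hG.locQ_smooth).mul hf)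

theorem locH_smooth (hG : IsMetricOn G U) (hf : ContDiffOn ℝ ∞ f U) (lam : ℝ) :
    ContDiffOn ℝ ∞ (locH G lam f) U :=
  (((hG.locP_smooth hf).sub ((contDiffOn_const.mul hG.locQ_smooth).mul hf)).add
    (contDiffOn_const.mul (((hG.locJ_smooth.mul (hG.lap_smooth hf)).sub
      (hG.contract_smooth hG.schouten_smooth (hG.hess_smooth hf))).add
        ((contDiffOn_const.mul hG.locSigmaTwo_smooth).mul hf)))).add
    ((contDiffOn_const.mul (hG.locQ_smooth.sub (contDiffOn_const.mul hG.locSigmaTwo_smooth))).mul hf)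

end IsMetricOn

end

section

variable {n : ℕ} {U V : Set (E n)} {f h : E n → ℝ} {G G' : E n → Matrix (Fin n) (Fin n) ℝ}
  {y : E n} {Φ : E n → E n}

/-! ### The metric and the connection as bilinear maps -/

/-- Reduces a multilinear identity to basis vectors, one argument at a time; this is how `koszul` is
derived from the coordinate formula for the Christoffel symbols. -/
theorem stdVec_induction {P : E n → Prop} (h0 : P 0) (hs : ∀ i, P (stdVec i))
    (hadd : ∀ u v, P u → P v → P (u + v)) (hsmul : ∀ (a : ℝ) u, P u → P (a • u)) (u : E n) :
    P u := by
  rw [← (EuclideanSpace.basisFun (Fin n) ℝ).sum_repr u]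
  refine Finset.sum_induction _ P hadd h0 fun i _ => hsmul _ _ ?_
  simpa using hs i

theorem sum_smul_stdVec (u : E n) : ∑ i, u i • stdVec i = u := by
  simpa using (EuclideanSpace.basisFun (Fin n) ℝ).sum_repr u

/-- The bilinear form of the metric with matrix `G`. -/
def metricForm (G : E n → Matrix (Fin n) (Fin n) ℝ) (y : E n) : E n →L[ℝ] E n →L[ℝ] ℝ :=
  ∑ i, ∑ j, G y i j •
    (EuclideanSpace.proj i : E n →L[ℝ] ℝ).smulRight (EuclideanSpace.proj j : E n →L[ℝ] ℝ)

/-- The Christoffel symbols of `G` as a bilinear map `(u, v) ↦ Γ^k_{ij} u^i v^j e_k`. -/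
def connForm (G : E n → Matrix (Fin n) (Fin n) ℝ) (y : E n) : E n →L[ℝ] E n →L[ℝ] E n :=
  ∑ k, ∑ i, ∑ j, christoffel G k i j y •
    (EuclideanSpace.proj i : E n →L[ℝ] ℝ).smulRight
      ((EuclideanSpace.proj j : E n →L[ℝ] ℝ).smulRight (stdVec k))

theorem metricForm_apply (u v : E n) :
    metricForm G y u v = ∑ i, ∑ j, G y i j * (u i * v j) := by
  simp [metricForm]

@[simp]
theorem metricForm_stdVec (i j : Fin n) : metricForm G y (stdVec i) (stdVec j) = G y i j := by
  simp [metricForm_apply]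

theorem connForm_apply (u v : E n) (k : Fin n) :
    connForm G y u v k = ∑ i, ∑ j, christoffel G k i j y * (u i * v j) := by
  simp [connForm, Pi.single_apply, Finset.sum_apply]

theorem connForm_stdVec (i j k : Fin n) :
    connForm G y (stdVec i) (stdVec j) k = christoffel G k i j y := by
  simp [connForm_apply]

theorem fderiv_apply₂ {W : Type*} [NormedAddCommGroup W] [NormedSpace ℝ W]
    {F : E n → E n →L[ℝ] E n →L[ℝ] W} {u v : E n → E n} (hF : DifferentiableAt ℝ F y)
    (hu : DifferentiableAt ℝ u y) (hv : DifferentiableAt ℝ v y) (c : E n) :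
    fderiv ℝ (fun z => F z (u z) (v z)) y c =
      fderiv ℝ F y c (u y) (v y) + F y (fderiv ℝ u y c) (v y) + F y (u y) (fderiv ℝ v y c) := by
  have := (hF.hasFDerivAt.clm_apply hu.hasFDerivAt).clm_apply hv.hasFDerivAt
  rw [this.fderiv]
  simp [add_comm]

theorem fderiv_apply₂_const {W : Type*} [NormedAddCommGroup W] [NormedSpace ℝ W]
    {F : E n → E n →L[ℝ] E n →L[ℝ] W} (hF : DifferentiableAt ℝ F y) (u v c : E n) :
    fderiv ℝ (fun z => F z u v) y c = fderiv ℝ F y c u v := by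
  rw [fderiv_apply₂ hF (by fun_prop) (by fun_prop)]
  simp

theorem contDiffOn_smul_const {W : Type*} [NormedAddCommGroup W] [NormedSpace ℝ W]
    (hf : ContDiffOn ℝ ∞ f U) (w : W) : ContDiffOn ℝ ∞ (fun z => f z • w) U :=
  hf.smul contDiffOn_const

namespace IsMetricOn

theorem metricForm_smooth (hG : IsMetricOn G U) : ContDiffOn ℝ ∞ (metricForm G) U :=
  ContDiffOn.sum fun i _ => ContDiffOn.sum fun j _ => contDiffOn_smul_const (hG.smooth i j) _

theorem connForm_smooth (hG : IsMetricOn G U) : ContDiffOn ℝ ∞ (connForm G) U :=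
  ContDiffOn.sum fun k _ => ContDiffOn.sum fun i _ => ContDiffOn.sum fun j _ =>
    contDiffOn_smul_const (hG.christoffel_smooth k i j) _

theorem metricForm_symm (hG : IsMetricOn G U) (hy : y ∈ U) (u v : E n) :
    metricForm G y u v = metricForm G y v u := by
  rw [metricForm_apply, metricForm_apply, Finset.sum_comm]
  refine Finset.sum_congr rfl fun i _ => Finset.sum_congr rfl fun j _ => ?_
  rw [hG.symm hy]; ring

theorem metricForm_pos (hG : IsMetricOn G U) (hy : y ∈ U) {u : E n} (hu : u ≠ 0) :
    0 < metricForm G y u u := by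
  have hu' : (fun i => u i) ≠ 0 := fun h => hu (by ext i; exact congrFun h i)
  have := (hG.posDef y hy).dotProduct_mulVec_pos hu'
  rw [metricForm_apply]
  refine this.trans_eq ?_
  simp only [dotProduct, Matrix.mulVec, Finset.mul_sum, Pi.star_apply, star_trivial]
  refine Finset.sum_congr rfl fun i _ => Finset.sum_congr rfl fun j _ => ?_
  ring

/-- Nondegeneracy, by testing against `u - v`. It upgrades scalar identities coming from the Koszul
formula to vector identities. -/
theorem metricForm_ext (hG : IsMetricOn G U) (hy : y ∈ U) {u v : E n}
    (h : ∀ w, metricForm G y u w = metricForm G y v w) : u = v := by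
  by_contra hne
  have := hG.metricForm_pos hy (sub_ne_zero.2 hne)
  have h' := h (u - v)
  rw [map_sub (metricForm G y), sub_apply, h', sub_self] at this
  exact lt_irrefl _ this

theorem pd_entry (hG : IsMetricOn G U) (hy : y ∈ U) (i j k : Fin n) :
    pd k (fun z => G z i j) y = fderiv ℝ (metricForm G) y (stdVec k) (stdVec i) (stdVec j) := by
  rw [← fderiv_apply₂_const (differentiableAt_of_contDiffOn hG.isOpen hG.metricForm_smooth hy)]
  simp [pd]

theorem pd_christoffel (hG : IsMetricOn G U) (hy : y ∈ U) (i j k l : Fin n) :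
    pd l (christoffel G k i j) y =
      fderiv ℝ (connForm G) y (stdVec l) (stdVec i) (stdVec j) k := by
  have hd := differentiableAt_of_contDiffOn hG.isOpen hG.connForm_smooth hy
  rw [← fderiv_apply₂_const hd]
  have h2 : DifferentiableAt ℝ (fun z => connForm G z (stdVec i) (stdVec j)) y := by fun_prop
  have h1 : christoffel G k i j =
      fun z => (EuclideanSpace.proj k : E n →L[ℝ] ℝ) (connForm G z (stdVec i) (stdVec j)) := by
    ext z; simp [connForm_stdVec]
  rw [pd, h1]
  erw [((EuclideanSpace.proj k : E n →L[ℝ] ℝ).hasFDerivAt.comp y h2.hasFDerivAt).fderiv]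
  rfl

/-- Pairing with the metric cancels the inverse matrix in the Christoffel symbol. In this form the
connection is characterised by the metric and its first derivative alone, so its behaviour under a
change of coordinates can be found by differentiating the pulled-back metric. -/
theorem koszul (hG : IsMetricOn G U) (hy : y ∈ U) (u v w : E n) :
    2 * metricForm G y (connForm G y u v) w =
      fderiv ℝ (metricForm G) y u v w + fderiv ℝ (metricForm G) y v u w
        - fderiv ℝ (metricForm G) y w u v := by
  induction u using stdVec_induction with
  | h0 => simp
  | hadd u₁ u₂ h₁ h₂ => simp only [map_add, add_apply, mul_add, h₁, h₂]; ring
  | hsmul a u h =>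
    simp only [map_smul, smul_apply, smul_eq_mul] at h ⊢
    linear_combination a * h
  | hs i =>
  induction v using stdVec_induction with
  | h0 => simp
  | hadd u₁ u₂ h₁ h₂ => simp only [map_add, add_apply, mul_add, h₁, h₂]; ring
  | hsmul a u h =>
    simp only [map_smul, smul_apply, smul_eq_mul] at h ⊢
    linear_combination a * h
  | hs j =>
  induction w using stdVec_induction with
  | h0 => simp
  | hadd u₁ u₂ h₁ h₂ => simp only [map_add, add_apply, mul_add, h₁, h₂]; ring
  | hsmul a u h =>
    simp only [map_smul, smul_apply, smul_eq_mul] at h ⊢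
    linear_combination a * h
  | hs l =>
  rw [← hG.pd_entry hy, ← hG.pd_entry hy, ← hG.pd_entry hy]
  rw [hG.metricForm_symm hy, metricForm_apply]
  simp only [connForm_stdVec, christoffel]
  have h1 := Matrix.mul_nonsing_inv (G y) (hG.isUnit_det hy)
  set K : Fin n → ℝ := fun m => pd i (fun z => G z j m) y + pd j (fun z => G z i m) y -
    pd m (fun z => G z i j) y with hK
  have h2 : (G y *ᵥ ((G y)⁻¹ *ᵥ K)) l = K l := by rw [Matrix.mulVec_mulVec, h1, Matrix.one_mulVec]
  have h3 : ∑ a, ∑ b, G y a b * ((stdVec l : E n) a * (1 / 2 * ∑ m, (G y)⁻¹ b m * K m)) =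
      (1 / 2) * (G y *ᵥ ((G y)⁻¹ *ᵥ K)) l := by
    rw [Finset.sum_eq_single l]
    · simp only [Matrix.mulVec, dotProduct, Finset.mul_sum]
      simp
      refine Finset.sum_congr rfl fun a _ => Finset.sum_congr rfl fun b _ => ?_
      ring
    · intro b _ hb
      simp [hb]
    · simp
  rw [h3, h2, hK]
  ring

end IsMetricOn

end

/-! ### Second derivatives, curvature and Ricci without indices -/

section

variable {n : ℕ} {U V : Set (E n)} {f h : E n → ℝ} {G G' : E n → Matrix (Fin n) (Fin n) ℝ}
  {y : E n} {Φ : E n → E n}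

theorem fderiv_congr_of_isOpen {W : Type*} [NormedAddCommGroup W] [NormedSpace ℝ W]
    {F F' : E n → W} (hU : IsOpen U) (hy : y ∈ U) (h : ∀ z ∈ U, F z = F' z) :
    fderiv ℝ F y = fderiv ℝ F' y :=
  Filter.EventuallyEq.fderiv_eq (Filter.eventually_of_mem (hU.mem_nhds hy) h)

theorem fderiv_fderiv_apply {W : Type*} [NormedAddCommGroup W] [NormedSpace ℝ W] {F : E n → W}
    (hU : IsOpen U) (hF : ContDiffOn ℝ ∞ F U) (hy : y ∈ U) (u v : E n) :
    fderiv ℝ (fun z => fderiv ℝ F z u) y v = fderiv ℝ (fderiv ℝ F) y v u := by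
  have hd := differentiableAt_of_contDiffOn hU (contDiffOn_fderiv hU hF) hy
  rw [fderiv_clm_apply hd (by fun_prop)]
  simp

theorem fderiv_fderiv_symm {W : Type*} [NormedAddCommGroup W] [NormedSpace ℝ W] {F : E n → W}
    (hU : IsOpen U) (hF : ContDiffOn ℝ ∞ F U) (hy : y ∈ U) (u v : E n) :
    fderiv ℝ (fderiv ℝ F) y u v = fderiv ℝ (fderiv ℝ F) y v u :=
  ((hF.contDiffAt (hU.mem_nhds hy)).isSymmSndFDerivAt
    (by rw [minSmoothness_of_isRCLikeNormedField]; exact ENat.LEInfty.out)).eq u v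

/-- The curvature tensor `R(c, a) b` of `G`. -/
def curvForm (G : E n → Matrix (Fin n) (Fin n) ℝ) (y c a b : E n) : E n :=
  fderiv ℝ (connForm G) y c b a - fderiv ℝ (connForm G) y a b c
    + connForm G y c (connForm G y b a) - connForm G y a (connForm G y b c)

theorem isLinearMap_curvForm_left (y a b : E n) :
    IsLinearMap ℝ (fun c => curvForm G y c a b) where
  map_add u v := by simp only [curvForm, map_add, add_apply]; abel
  map_smul r u := by simp only [curvForm, map_smul, smul_apply, smul_add, smul_sub]

theorem isLinearMap_curvForm_mid (y c b : E n) :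
    IsLinearMap ℝ (fun a => curvForm G y c a b) where
  map_add u v := by simp only [curvForm, map_add, add_apply]; abel
  map_smul r u := by simp only [curvForm, map_smul, smul_apply, smul_add, smul_sub]

theorem isLinearMap_curvForm_right (y c a : E n) :
    IsLinearMap ℝ (fun b => curvForm G y c a b) where
  map_add u v := by simp only [curvForm, map_add, add_apply]; abel
  map_smul r u := by simp only [curvForm, map_smul, smul_apply, smul_add, smul_sub]

/-- Formulated for bare functions rather than bundled maps, so that it also applies to traces such
as the Ricci form. -/
theorem bilinear_expand {B : E n → E n → ℝ} (h₁ : ∀ v, IsLinearMap ℝ fun u => B u v)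
    (h₂ : ∀ u, IsLinearMap ℝ fun v => B u v) (u v : E n) :
    B u v = ∑ k, ∑ l, u k * B (stdVec k) (stdVec l) * v l := by
  have e1 : B u v = ∑ k, u k * B (stdVec k) v := by
    have := map_sum (h₁ v).mk' (fun i => u i • stdVec i) Finset.univ
    simpa only [sum_smul_stdVec, IsLinearMap.mk'_apply, (h₁ v).map_smul, smul_eq_mul] using this
  rw [e1]
  refine Finset.sum_congr rfl fun k _ => ?_
  have := map_sum (h₂ (stdVec k)).mk' (fun i => v i • stdVec i) Finset.univ
  simp only [sum_smul_stdVec, IsLinearMap.mk'_apply, (h₂ (stdVec k)).map_smul] at this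
  rw [this, Finset.mul_sum]
  refine Finset.sum_congr rfl fun l _ => ?_
  simp only [smul_eq_mul]; ring

/-- The trace of a linear map in the standard basis is invariant under conjugation. -/
theorem sum_apply_eq_of_conj {L L' : E n → E n} (hL : IsLinearMap ℝ L) (hL' : IsLinearMap ℝ L')
    {T : E n →L[ℝ] E n} (hT : Function.Injective T) (h : ∀ c, T (L' c) = L (T c)) :
    ∑ k, L' (stdVec k) k = ∑ k, L (stdVec k) k := by
  have tr : ∀ {L : E n → E n} (hL : IsLinearMap ℝ L),
      ∑ k, L (stdVec k) k = LinearMap.trace ℝ (E n) hL.mk' := by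
    intro L hL
    rw [LinearMap.trace_eq_sum_inner _ (EuclideanSpace.basisFun (Fin n) ℝ)]
    simp [PiLp.inner_apply]
  -- An injective endomorphism in finite dimension is invertible, so the hypothesis says that L' =
  -- T⁻¹ L T.
  let e : E n ≃ₗ[ℝ] E n := LinearEquiv.ofInjectiveEndo (T : E n →ₗ[ℝ] E n) hT
  rw [tr hL, tr hL', ← LinearMap.trace_conj' hL'.mk' e]
  congr 1
  ext1 x
  obtain ⟨c, rfl⟩ := e.surjective x
  simp only [LinearEquiv.conj_apply, LinearMap.comp_apply, LinearEquiv.coe_coe,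
    LinearEquiv.symm_apply_apply, IsLinearMap.mk'_apply]
  exact h c

namespace IsMetricOn

theorem fderiv_metricForm_symm (hG : IsMetricOn G U) (hy : y ∈ U) (u v w : E n) :
    fderiv ℝ (metricForm G) y u v w = fderiv ℝ (metricForm G) y u w v := by
  have hd := differentiableAt_of_contDiffOn hG.isOpen hG.metricForm_smooth hy
  rw [← fderiv_apply₂_const hd, ← fderiv_apply₂_const hd,
    fderiv_congr_of_isOpen hG.isOpen hy fun z hz => hG.metricForm_symm hz v w]

/-- The connection has no torsion: the right side of the Koszul formula is symmetric in its first
two arguments. -/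
theorem connForm_symm (hG : IsMetricOn G U) (hy : y ∈ U) (u v : E n) :
    connForm G y u v = connForm G y v u := by
  refine hG.metricForm_ext hy fun w => ?_
  have h1 := hG.koszul hy u v w
  have h2 := hG.koszul hy v u w
  rw [hG.fderiv_metricForm_symm hy w v u] at h2
  linarith

/-- Exhibits Ricci as the trace of c ↦ R(c, a)b, so that its tensoriality follows from that of the
curvature and from the invariance of traces under conjugation. -/
theorem ricci_eq (hG : IsMetricOn G U) (hy : y ∈ U) (i j : Fin n) :
    ricci G i j y = ∑ k, curvForm G y (stdVec k) (stdVec j) (stdVec i) k := by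
  rw [ricci, ← Finset.sum_add_distrib]
  refine Finset.sum_congr rfl fun k _ => ?_
  have key : ∀ a b c : Fin n, connForm G y (stdVec a) (connForm G y (stdVec b) (stdVec c)) k =
      ∑ l, christoffel G k a l y * christoffel G l b c y := by
    intro a b c
    rw [connForm_apply, Finset.sum_eq_single a (by intro x _ hx; simp [hx]) (by simp)]
    simp [connForm_stdVec]
  simp only [curvForm, PiLp.add_apply, PiLp.sub_apply, key, hG.pd_christoffel hy,
    Finset.sum_sub_distrib]
  ring

theorem hess_eq (hG : IsMetricOn G U) (hf : ContDiffOn ℝ ∞ f U) (hy : y ∈ U) (i j : Fin n) :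
    hess G f i j y = fderiv ℝ (fderiv ℝ f) y (stdVec i) (stdVec j)
      - fderiv ℝ f y (connForm G y (stdVec i) (stdVec j)) := by
  have h1 : pd i (pd j f) y = fderiv ℝ (fderiv ℝ f) y (stdVec i) (stdVec j) :=
    fderiv_fderiv_apply hG.isOpen hf hy _ _
  rw [hess, h1]
  congr 1
  conv_rhs => rw [← sum_smul_stdVec (connForm G y (stdVec i) (stdVec j)), map_sum]
  simp [connForm_stdVec, pd]

end IsMetricOn

/-! ### Change of coordinates -/

/-- The metric `G'` on `V` is the pullback of the metric `G` on `U` by the smooth map `Φ`. -/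
structure IsPullback (Φ : E n → E n) (G' : E n → Matrix (Fin n) (Fin n) ℝ) (V : Set (E n))
    (G : E n → Matrix (Fin n) (Fin n) ℝ) (U : Set (E n)) : Prop where
  source : IsMetricOn G' V
  target : IsMetricOn G U
  smooth : ContDiffOn ℝ ∞ Φ V
  mapsTo : ∀ y ∈ V, Φ y ∈ U
  entry : ∀ y ∈ V, ∀ i j,
    G' y i j = metricForm G (Φ y) (fderiv ℝ Φ y (stdVec i)) (fderiv ℝ Φ y (stdVec j))

namespace IsPullback

theorem metricForm_eq (hP : IsPullback Φ G' V G U) (hy : y ∈ V) (a b : E n) :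
    metricForm G' y a b = metricForm G (Φ y) (fderiv ℝ Φ y a) (fderiv ℝ Φ y b) := by
  rw [bilinear_expand (B := fun a b => metricForm G (Φ y) (fderiv ℝ Φ y a) (fderiv ℝ Φ y b))
    (fun v => ⟨by simp, by simp⟩) (fun v => ⟨by simp, by simp⟩), metricForm_apply]
  refine Finset.sum_congr rfl fun i _ => Finset.sum_congr rfl fun j _ => ?_
  rw [hP.entry y hy]; ring

/-- A vector killed by the derivative would have length zero for the positive definite metric `G'`.
Thus `Φ` is locally invertible without this being part of the definition of a pullback. -/
theorem fderiv_injective (hP : IsPullback Φ G' V G U) (hy : y ∈ V) :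
    Function.Injective (fderiv ℝ Φ y) := by
  rw [injective_iff_map_eq_zero]
  intro a ha
  by_contra hne
  have := hP.source.metricForm_pos hy hne
  rw [hP.metricForm_eq hy, ha] at this
  simp at this

theorem fderiv_surjective (hP : IsPullback Φ G' V G U) (hy : y ∈ V) :
    Function.Surjective (fderiv ℝ Φ y) :=
  (LinearMap.injective_iff_surjective (f := (fderiv ℝ Φ y : E n →ₗ[ℝ] E n))).1
    (hP.fderiv_injective hy)

theorem differentiableAt (hP : IsPullback Φ G' V G U) (hy : y ∈ V) : DifferentiableAt ℝ Φ y :=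
  differentiableAt_of_contDiffOn hP.source.isOpen hP.smooth hy

theorem differentiableAt_fderiv_apply (hP : IsPullback Φ G' V G U) (hy : y ∈ V) (a : E n) :
    DifferentiableAt ℝ (fun z => fderiv ℝ Φ z a) y :=
  (differentiableAt_of_contDiffOn hP.source.isOpen
    (contDiffOn_fderiv hP.source.isOpen hP.smooth) hy).clm_apply (by fun_prop)

theorem fderiv_comp_apply (hP : IsPullback Φ G' V G U) (hy : y ∈ V)
    {W : Type*} [NormedAddCommGroup W] [NormedSpace ℝ W] {F : E n → W}
    (hF : ContDiffOn ℝ ∞ F U) (c : E n) :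
    fderiv ℝ (fun z => F (Φ z)) y c = fderiv ℝ F (Φ y) (fderiv ℝ Φ y c) := by
  have hF' := differentiableAt_of_contDiffOn hP.target.isOpen hF (hP.mapsTo y hy)
  have := (hF'.hasFDerivAt.comp y (hP.differentiableAt hy).hasFDerivAt).fderiv
  exact congrArg (fun L => L c) this

theorem contDiffOn_comp (hP : IsPullback Φ G' V G U)
    {W : Type*} [NormedAddCommGroup W] [NormedSpace ℝ W] {F : E n → W}
    (hF : ContDiffOn ℝ ∞ F U) : ContDiffOn ℝ ∞ (fun z => F (Φ z)) V :=
  hF.comp hP.smooth hP.mapsTo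

/-- The derivative of a bilinear map evaluated on the images of two fixed vectors. -/
theorem fderiv_comp_apply₂ (hP : IsPullback Φ G' V G U) (hy : y ∈ V)
    {W : Type*} [NormedAddCommGroup W] [NormedSpace ℝ W] {F : E n → E n →L[ℝ] E n →L[ℝ] W}
    (hF : ContDiffOn ℝ ∞ F U) (a b c : E n) :
    fderiv ℝ (fun z => F (Φ z) (fderiv ℝ Φ z a) (fderiv ℝ Φ z b)) y c =
      fderiv ℝ F (Φ y) (fderiv ℝ Φ y c) (fderiv ℝ Φ y a) (fderiv ℝ Φ y b)
        + F (Φ y) (fderiv ℝ (fderiv ℝ Φ) y c a) (fderiv ℝ Φ y b)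
        + F (Φ y) (fderiv ℝ Φ y a) (fderiv ℝ (fderiv ℝ Φ) y c b) := by
  have hF' := differentiableAt_of_contDiffOn hP.source.isOpen (hP.contDiffOn_comp hF) hy
  rw [fderiv_apply₂ hF' (hP.differentiableAt_fderiv_apply hy a)
    (hP.differentiableAt_fderiv_apply hy b), hP.fderiv_comp_apply hy hF,
    fderiv_fderiv_apply hP.source.isOpen hP.smooth hy,
    fderiv_fderiv_apply hP.source.isOpen hP.smooth hy]

/-- The transformation law of the Christoffel symbols: compare the Koszul formulas of the two
metrics, after differentiating the relation between them. Of the six terms containing the second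
derivative of `Φ`, four cancel in pairs by symmetry and two add up, which accounts for the
inhomogeneous term. -/
theorem connForm_eq (hP : IsPullback Φ G' V G U) (hy : y ∈ V) (a b : E n) :
    fderiv ℝ Φ y (connForm G' y a b) = fderiv ℝ (fderiv ℝ Φ) y a b
      + connForm G (Φ y) (fderiv ℝ Φ y a) (fderiv ℝ Φ y b) := by
  have hD : ∀ a b c, fderiv ℝ (metricForm G') y c a b = _ := fun a b c => by
    rw [← fderiv_apply₂_const (differentiableAt_of_contDiffOn hP.source.isOpen
        hP.source.metricForm_smooth hy),
      fderiv_congr_of_isOpen hP.source.isOpen hy fun z hz => hP.metricForm_eq hz a b,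
      hP.fderiv_comp_apply₂ hy hP.target.metricForm_smooth]
  refine hP.target.metricForm_ext (hP.mapsTo y hy) fun w => ?_
  obtain ⟨c, rfl⟩ := hP.fderiv_surjective hy w
  have h1 := hP.source.koszul hy a b c
  have h2 := hP.target.koszul (hP.mapsTo y hy) (fderiv ℝ Φ y a) (fderiv ℝ Φ y b) (fderiv ℝ Φ y c)
  rw [hD, hD, hD, hP.metricForm_eq hy] at h1
  have hs := fderiv_fderiv_symm hP.source.isOpen hP.smooth hy
  rw [hs b a, hs c a, hs c b] at h1
  rw [hP.target.metricForm_symm (hP.mapsTo y hy) (fderiv ℝ Φ y a)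
      (fderiv ℝ (fderiv ℝ Φ) y b c),
    hP.target.metricForm_symm (hP.mapsTo y hy) (fderiv ℝ Φ y b)
      (fderiv ℝ (fderiv ℝ Φ) y a c)] at h1
  rw [map_add, add_apply]
  linarith

/-- The transformation law of the connection, differentiated along `c`; it supplies the derivative
terms of the curvature. -/
theorem fderiv_connForm_eq (hP : IsPullback Φ G' V G U) (hy : y ∈ V) (a b c : E n) :
    fderiv ℝ (fderiv ℝ Φ) y c (connForm G' y a b)
        + fderiv ℝ Φ y (fderiv ℝ (connForm G') y c a b) =
      fderiv ℝ (fderiv ℝ (fderiv ℝ Φ)) y c a b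
        + fderiv ℝ (connForm G) (Φ y) (fderiv ℝ Φ y c) (fderiv ℝ Φ y a) (fderiv ℝ Φ y b)
        + connForm G (Φ y) (fderiv ℝ (fderiv ℝ Φ) y c a) (fderiv ℝ Φ y b)
        + connForm G (Φ y) (fderiv ℝ Φ y a) (fderiv ℝ (fderiv ℝ Φ) y c b) := by
  have hV := hP.source.isOpen
  have h1 := contDiffOn_fderiv hV hP.smooth
  have d1 := differentiableAt_of_contDiffOn hV h1 hy
  have d2 := differentiableAt_of_contDiffOn hV (contDiffOn_fderiv hV h1) hy
  have dc := differentiableAt_of_contDiffOn hV hP.source.connForm_smooth hy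
  have key := congrArg (fun L => L c)
    (fderiv_congr_of_isOpen hV hy fun z hz => hP.connForm_eq hz a b)
  have e1 : fderiv ℝ (fun z => fderiv ℝ Φ z (connForm G' z a b)) y c =
      fderiv ℝ (fderiv ℝ Φ) y c (connForm G' y a b)
        + fderiv ℝ Φ y (fderiv ℝ (connForm G') y c a b) := by
    rw [fderiv_clm_apply d1 (by fun_prop)]
    simp [← fderiv_apply₂_const dc, add_comm]
  have d3 : DifferentiableAt ℝ
      (fun z => connForm G (Φ z) (fderiv ℝ Φ z a) (fderiv ℝ Φ z b)) y :=
    ((differentiableAt_of_contDiffOn hV (hP.contDiffOn_comp hP.target.connForm_smooth) hy).clm_apply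
      (hP.differentiableAt_fderiv_apply hy a)).clm_apply (hP.differentiableAt_fderiv_apply hy b)
  simp only [e1] at key
  rw [key, fderiv_fun_add (by fun_prop) d3, add_apply, fderiv_apply₂_const d2,
    hP.fderiv_comp_apply₂ hy hP.target.connForm_smooth]
  abel

/-- Antisymmetrising the differentiated law in `c` and `a` removes the third derivative of `Φ`, and
the remaining second-derivative terms cancel against those produced by the quadratic part of the
curvature. -/
theorem curvForm_eq (hP : IsPullback Φ G' V G U) (hy : y ∈ V) (c a b : E n) :
    fderiv ℝ Φ y (curvForm G' y c a b) =
      curvForm G (Φ y) (fderiv ℝ Φ y c) (fderiv ℝ Φ y a) (fderiv ℝ Φ y b) := by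
  have hV := hP.source.isOpen
  have h1 := contDiffOn_fderiv hV hP.smooth
  have hs := fderiv_fderiv_symm hV hP.smooth hy
  have d2 := differentiableAt_of_contDiffOn hV (contDiffOn_fderiv hV h1) hy
  have hs3 : ∀ u v w, fderiv ℝ (fderiv ℝ (fderiv ℝ Φ)) y u v w =
      fderiv ℝ (fderiv ℝ (fderiv ℝ Φ)) y u w v := by
    intro u v w
    rw [← fderiv_apply₂_const d2, ← fderiv_apply₂_const d2,
      fderiv_congr_of_isOpen hV hy fun z hz => fderiv_fderiv_symm hV hP.smooth hz v w]
  have hs3' : ∀ u v, fderiv ℝ (fderiv ℝ (fderiv ℝ Φ)) y u v =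
      fderiv ℝ (fderiv ℝ (fderiv ℝ Φ)) y v u := fderiv_fderiv_symm hV h1 hy
  have hD3 : fderiv ℝ (fderiv ℝ (fderiv ℝ Φ)) y c b a =
      fderiv ℝ (fderiv ℝ (fderiv ℝ Φ)) y a b c := by
    rw [hs3' c b, hs3 b c a, hs3' b a]
  have l1 := hP.fderiv_connForm_eq hy b a c
  have l2 := hP.fderiv_connForm_eq hy b c a
  have k1 := hP.connForm_eq hy c (connForm G' y b a)
  have k2 := hP.connForm_eq hy a (connForm G' y b c)
  rw [hP.connForm_eq hy b a, map_add] at k1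
  rw [hP.connForm_eq hy b c, map_add] at k2
  have s1 := hP.target.connForm_symm (hP.mapsTo y hy) (fderiv ℝ (fderiv ℝ Φ) y c b)
    (fderiv ℝ Φ y a)
  have s2 := hP.target.connForm_symm (hP.mapsTo y hy) (fderiv ℝ (fderiv ℝ Φ) y a b)
    (fderiv ℝ Φ y c)
  rw [s1, hs c b] at l1
  rw [s2, hs a b, ← hD3, hs a c] at l2
  rw [← eq_sub_iff_add_eq'] at l1 l2
  simp only [curvForm, map_add, map_sub, k1, k2, l1, l2]
  abel

end IsPullback

end

/-! ### Transformation laws of tensors and operators -/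

section

variable {n : ℕ} {U V : Set (E n)} {f h f' h' : E n → ℝ} {G G' : E n → Matrix (Fin n) (Fin n) ℝ}
  {y : E n} {Φ : E n → E n}

/-- The Jacobian matrix of `Φ`. -/
def jac (Φ : E n → E n) (y : E n) : Matrix (Fin n) (Fin n) ℝ :=
  Matrix.of fun k i => fderiv ℝ Φ y (stdVec i) k

theorem fderiv_apply_eq_jac_mulVec (Φ : E n → E n) (y w : E n) :
    (fun k => fderiv ℝ Φ y w k) = jac Φ y *ᵥ (fun i => w i) := by
  ext k
  conv_lhs => rw [← sum_smul_stdVec w, map_sum]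
  simp [jac, Matrix.mulVec, dotProduct, mul_comm]

/-- The matrix of a bilinear form, evaluated on images of basis vectors. -/
theorem bilinear_eq_jac {B : E n → E n → ℝ} (h₁ : ∀ v, IsLinearMap ℝ fun u => B u v)
    (h₂ : ∀ u, IsLinearMap ℝ fun v => B u v) (i j : Fin n) :
    B (fderiv ℝ Φ y (stdVec i)) (fderiv ℝ Φ y (stdVec j)) =
      ((jac Φ y)ᵀ * Matrix.of (fun k l => B (stdVec k) (stdVec l)) * jac Φ y) i j := by
  rw [bilinear_expand h₁ h₂, Finset.sum_comm]
  simp only [Matrix.mul_apply, Matrix.transpose_apply, Matrix.of_apply, Finset.sum_mul]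
  rfl

theorem contract_eq_trace (S T : Fin n → Fin n → ℝ) (y : E n) :
    contract G S T y =
      (Matrix.of S * (G y)⁻¹ * (Matrix.of T)ᵀ * ((G y)⁻¹)ᵀ).trace := by
  simp only [contract, Matrix.trace, Matrix.diag, Matrix.mul_apply, Matrix.transpose_apply,
    Matrix.of_apply, Finset.sum_mul]
  refine Finset.sum_congr rfl fun i _ => ?_
  rw [Finset.sum_comm]
  refine Finset.sum_congr rfl fun k _ => ?_
  rw [Finset.sum_comm]
  refine Finset.sum_congr rfl fun l _ => Finset.sum_congr rfl fun j _ => ?_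
  ring

theorem sum_inv_mul_eq_trace (S : Fin n → Fin n → ℝ) (y : E n) :
    ∑ i, ∑ j, (G y)⁻¹ i j * S i j = ((G y)⁻¹ * (Matrix.of S)ᵀ).trace := by
  simp only [Matrix.trace, Matrix.diag, Matrix.mul_apply, Matrix.transpose_apply, Matrix.of_apply]

theorem grad_eq_mulVec (G : E n → Matrix (Fin n) (Fin n) ℝ) (f : E n → ℝ) (y : E n) :
    (fun i => grad G f i y) = (G y)⁻¹ *ᵥ (fun j => pd j f y) := by
  ext i; simp [grad, Matrix.mulVec, dotProduct]

/-- The divergence is the trace of the covariant derivative c ↦ DX(c) + Γ(c, X), a form to which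
conjugation invariance applies. -/
theorem divg_eq (X : Fin n → E n → ℝ) (hX : ∀ i, DifferentiableAt ℝ (X i) y) :
    divg G X y = ∑ k, (fderiv ℝ (fun z => WithLp.toLp 2 (fun i => X i z) : E n → E n) y (stdVec k)
      + connForm G y (stdVec k) (WithLp.toLp 2 (fun i => X i y))) k := by
  have hd : HasFDerivAt (fun z => WithLp.toLp 2 (fun i => X i z) : E n → E n)
      (((PiLp.continuousLinearEquiv 2 ℝ (fun _ : Fin n => ℝ)).symm :
        (Fin n → ℝ) →L[ℝ] E n).comp (ContinuousLinearMap.pi fun i => fderiv ℝ (X i) y)) y :=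
    ((PiLp.continuousLinearEquiv 2 ℝ (fun _ : Fin n => ℝ)).symm :
      (Fin n → ℝ) →L[ℝ] E n).hasFDerivAt.comp y (hasFDerivAt_pi.2 fun i => (hX i).hasFDerivAt)
  rw [hd.fderiv, divg, ← Finset.sum_add_distrib]
  refine Finset.sum_congr rfl fun k _ => ?_
  rw [PiLp.add_apply, connForm_apply,
    Finset.sum_eq_single (f := fun i => ∑ j, christoffel G k i j y * _) k
      (by intro x _ hx; simp [hx]) (by simp)]
  simp [pd]

namespace IsPullback

theorem matrix_eq (hP : IsPullback Φ G' V G U) (hy : y ∈ V) :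
    G' y = (jac Φ y)ᵀ * G (Φ y) * jac Φ y := by
  ext i j
  rw [hP.entry y hy, bilinear_eq_jac (B := fun a b => metricForm G (Φ y) a b)
    (fun v => ⟨by simp, by simp⟩) (fun v => ⟨by simp, by simp⟩)]
  simp only [metricForm_stdVec]
  rfl

theorem isUnit_det_jac (hP : IsPullback Φ G' V G U) (hy : y ∈ V) : IsUnit (jac Φ y).det := by
  have h1 := (hP.source.det_pos hy).ne'
  rw [hP.matrix_eq hy, Matrix.det_mul] at h1
  exact (right_ne_zero_of_mul h1).isUnit

/-- The contravariant law for the inverse metric; every contraction and every raised index below is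
transported by it. -/
theorem jac_inv (hP : IsPullback Φ G' V G U) (hy : y ∈ V) :
    jac Φ y * ((G' y)⁻¹ * (jac Φ y)ᵀ) = (G (Φ y))⁻¹ := by
  have hu := hP.isUnit_det_jac hy
  have hut : IsUnit ((jac Φ y)ᵀ).det := by rwa [Matrix.det_transpose]
  rw [hP.matrix_eq hy, Matrix.mul_inv_rev, Matrix.mul_inv_rev, Matrix.mul_assoc,
    Matrix.mul_assoc, Matrix.nonsing_inv_mul _ hut, Matrix.mul_one, ← Matrix.mul_assoc,
    Matrix.mul_nonsing_inv _ hu, Matrix.one_mul]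

theorem contract_eq (hP : IsPullback Φ G' V G U) (hy : y ∈ V) {S T S' T' : Fin n → Fin n → ℝ}
    (hS : Matrix.of S' = (jac Φ y)ᵀ * Matrix.of S * jac Φ y)
    (hT : Matrix.of T' = (jac Φ y)ᵀ * Matrix.of T * jac Φ y) :
    contract G' S' T' y = contract G S T (Φ y) := by
  have h1 := hP.jac_inv hy
  have h2 : jac Φ y * (((G' y)⁻¹)ᵀ * (jac Φ y)ᵀ) = ((G (Φ y))⁻¹)ᵀ := by
    rw [← h1]; simp [Matrix.transpose_mul, Matrix.mul_assoc]
  rw [contract_eq_trace, contract_eq_trace, hS, hT, ← h2, ← h1]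
  simp only [Matrix.transpose_mul, Matrix.transpose_transpose, Matrix.mul_assoc]
  rw [Matrix.trace_mul_comm]
  simp only [Matrix.mul_assoc]

theorem trace_eq (hP : IsPullback Φ G' V G U) (hy : y ∈ V) {S S' : Fin n → Fin n → ℝ}
    (hS : Matrix.of S' = (jac Φ y)ᵀ * Matrix.of S * jac Φ y) :
    ∑ i, ∑ j, (G' y)⁻¹ i j * S' i j = ∑ i, ∑ j, (G (Φ y))⁻¹ i j * S i j := by
  rw [sum_inv_mul_eq_trace, sum_inv_mul_eq_trace, hS, ← hP.jac_inv hy]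
  simp only [Matrix.transpose_mul, Matrix.transpose_transpose]
  rw [Matrix.trace_mul_comm, Matrix.mul_assoc, Matrix.mul_assoc, Matrix.trace_mul_comm]
  simp only [Matrix.mul_assoc]
  rw [Matrix.trace_mul_comm]
  simp only [Matrix.mul_assoc]

theorem ricci_eq (hP : IsPullback Φ G' V G U) (hy : y ∈ V) :
    Matrix.of (fun i j => ricci G' i j y) =
      (jac Φ y)ᵀ * Matrix.of (fun i j => ricci G i j (Φ y)) * jac Φ y := by
  ext i j
  have h1 : ∑ k, curvForm G' y (stdVec k) (stdVec j) (stdVec i) k =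
      ∑ k, curvForm G (Φ y) (stdVec k) (fderiv ℝ Φ y (stdVec j)) (fderiv ℝ Φ y (stdVec i)) k :=
    sum_apply_eq_of_conj (isLinearMap_curvForm_left _ _ _) (isLinearMap_curvForm_left _ _ _)
      (hP.fderiv_injective hy) fun c => hP.curvForm_eq hy c _ _
  rw [Matrix.of_apply, hP.source.ricci_eq hy, h1,
    bilinear_eq_jac (B := fun b a => ∑ k, curvForm G (Φ y) (stdVec k) a b k)]
  · simp only [hP.target.ricci_eq (hP.mapsTo y hy)]
  · intro a
    refine ⟨fun u v => ?_, fun r u => ?_⟩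
    · simp only [(isLinearMap_curvForm_right _ _ _).map_add, PiLp.add_apply,
        Finset.sum_add_distrib]
    · simp only [(isLinearMap_curvForm_right _ _ _).map_smul, PiLp.smul_apply, Finset.smul_sum]
  · intro a
    refine ⟨fun u v => ?_, fun r u => ?_⟩
    · simp only [(isLinearMap_curvForm_mid _ _ _).map_add, PiLp.add_apply,
        Finset.sum_add_distrib]
    · simp only [(isLinearMap_curvForm_mid _ _ _).map_smul, PiLp.smul_apply, Finset.smul_sum]

/-- The second derivative of f ∘ Φ contains the extra term Df(D²Φ), which is exactly what the
inhomogeneous term of `connForm_eq` subtracts. -/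
theorem hess_eq (hP : IsPullback Φ G' V G U) (hf : ContDiffOn ℝ ∞ f U)
    (hff : ∀ z ∈ V, f' z = f (Φ z)) (hy : y ∈ V) :
    Matrix.of (fun i j => hess G' f' i j y) =
      (jac Φ y)ᵀ * Matrix.of (fun i j => hess G f i j (Φ y)) * jac Φ y := by
  have hV := hP.source.isOpen
  have hfc : ContDiffOn ℝ ∞ f' V := (hP.contDiffOn_comp hf).congr hff
  have hd1 : ∀ z ∈ V, ∀ c, fderiv ℝ f' z c = fderiv ℝ f (Φ z) (fderiv ℝ Φ z c) := by
    intro z hz c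
    rw [fderiv_congr_of_isOpen hV hz hff, hP.fderiv_comp_apply hz hf]
  have hdf := contDiffOn_fderiv hP.target.isOpen hf
  have hd2 : ∀ a b, fderiv ℝ (fderiv ℝ f') y a b =
      fderiv ℝ (fderiv ℝ f) (Φ y) (fderiv ℝ Φ y a) (fderiv ℝ Φ y b)
        + fderiv ℝ f (Φ y) (fderiv ℝ (fderiv ℝ Φ) y a b) := by
    intro a b
    rw [← fderiv_fderiv_apply hV hfc hy, fderiv_congr_of_isOpen hV hy fun z hz => hd1 z hz b,
      fderiv_clm_apply (differentiableAt_of_contDiffOn hV (hP.contDiffOn_comp hdf) hy)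
        (hP.differentiableAt_fderiv_apply hy b)]
    simp [hP.fderiv_comp_apply hy hdf, fderiv_fderiv_apply hV hP.smooth hy, add_comm]
  ext i j
  rw [Matrix.of_apply, hP.source.hess_eq hfc hy, hd2, hd1 y hy, hP.connForm_eq hy, map_add]
  have := bilinear_eq_jac (Φ := Φ) (y := y) (B := fun a b => fderiv ℝ (fderiv ℝ f) (Φ y) a b -
    fderiv ℝ f (Φ y) (connForm G (Φ y) a b))
    (fun v => ⟨by intros; simp only [map_add, add_apply]; ring,
      by intros; simp only [map_smul, smul_apply, smul_sub]⟩)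
    (fun v => ⟨by intros; simp only [map_add]; ring,
      by intros; simp only [map_smul, smul_sub]⟩) i j
  simp only [← hP.target.hess_eq hf (hP.mapsTo y hy)] at this
  rw [← this]
  ring

theorem pd_eq (hP : IsPullback Φ G' V G U) (hf : ContDiffOn ℝ ∞ f U)
    (hff : ∀ z ∈ V, f' z = f (Φ z)) (hy : y ∈ V) :
    (fun i => pd i f' y) = (jac Φ y)ᵀ *ᵥ (fun i => pd i f (Φ y)) := by
  ext i
  rw [pd, fderiv_congr_of_isOpen hP.source.isOpen hy hff, hP.fderiv_comp_apply hy hf]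
  conv_lhs => rw [← sum_smul_stdVec (fderiv ℝ Φ y _), map_sum]
  simp [Matrix.mulVec, dotProduct, jac, pd]

theorem grad_eq (hP : IsPullback Φ G' V G U) (hf : ContDiffOn ℝ ∞ f U)
    (hff : ∀ z ∈ V, f' z = f (Φ z)) (hy : y ∈ V) :
    jac Φ y *ᵥ (fun i => grad G' f' i y) = (fun i => grad G f i (Φ y)) := by
  rw [grad_eq_mulVec, grad_eq_mulVec, hP.pd_eq hf hff hy, Matrix.mulVec_mulVec,
    Matrix.mulVec_mulVec, Matrix.mul_assoc, hP.jac_inv hy]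

/-- Raising an index of a covariant 2-tensor applied to a vector commutes with pullback. -/
theorem raise_eq (hP : IsPullback Φ G' V G U) (hy : y ∈ V) {S S' : Fin n → Fin n → ℝ}
    (hS : Matrix.of S' = (jac Φ y)ᵀ * Matrix.of S * jac Φ y) {v v' : Fin n → ℝ}
    (hv : jac Φ y *ᵥ v' = v) :
    jac Φ y *ᵥ (fun i => ∑ j, ∑ k, (G' y)⁻¹ i j * S' j k * v' k) =
      fun i => ∑ j, ∑ k, (G (Φ y))⁻¹ i j * S j k * v k := by
  have key : ∀ (A S : Matrix (Fin n) (Fin n) ℝ) (v : Fin n → ℝ),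
      (fun i => ∑ j, ∑ k, A i j * S j k * v k) = A *ᵥ (S *ᵥ v) := by
    intro A S v
    ext i
    simp only [Matrix.mulVec, dotProduct, Finset.mul_sum, mul_assoc]
  have k1 := key (G' y)⁻¹ (Matrix.of S') v'
  have k2 := key (G (Φ y))⁻¹ (Matrix.of S) v
  simp only [Matrix.of_apply] at k1 k2
  rw [k1, k2, hS, ← hv, ← hP.jac_inv hy]
  simp only [Matrix.mulVec_mulVec, Matrix.mul_assoc]

theorem sum_pd_mul_eq (hP : IsPullback Φ G' V G U) (hf : ContDiffOn ℝ ∞ f U)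
    (hff : ∀ z ∈ V, f' z = f (Φ z)) (hy : y ∈ V) {v v' : Fin n → ℝ}
    (hv : jac Φ y *ᵥ v' = v) :
    ∑ i, pd i f' y * v' i = ∑ i, pd i f (Φ y) * v i := by
  change (fun i => pd i f' y) ⬝ᵥ v' = (fun i => pd i f (Φ y)) ⬝ᵥ v
  rw [hP.pd_eq hf hff hy, ← hv, Matrix.mulVec_transpose, Matrix.dotProduct_mulVec]

/-- Differentiating DΦ·X' = X ∘ Φ and using the law for the connection, the terms with D²Φ cancel.
The two covariant derivatives are therefore conjugate by DΦ and have the same trace. -/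
theorem divg_eq (hP : IsPullback Φ G' V G U) (hy : y ∈ V) {X X' : Fin n → E n → ℝ}
    (hX : ∀ i, ContDiffOn ℝ ∞ (X i) U) (hX' : ∀ i, ContDiffOn ℝ ∞ (X' i) V)
    (hXX : ∀ z ∈ V, jac Φ z *ᵥ (fun i => X' i z) = fun i => X i (Φ z)) :
    divg G' X' y = divg G X (Φ y) := by
  have hV := hP.source.isOpen
  have hW : ContDiffOn ℝ ∞ (fun z => WithLp.toLp 2 (fun i => X i z) : E n → E n) U :=
    (contDiffOn_piLp 2).2 fun i => hX i
  have hW' : ContDiffOn ℝ ∞ (fun z => WithLp.toLp 2 (fun i => X' i z) : E n → E n) V :=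
    (contDiffOn_piLp 2).2 fun i => hX' i
  rw [PaneitzH.divg_eq X' fun i => differentiableAt_of_contDiffOn hV (hX' i) hy,
    PaneitzH.divg_eq X fun i =>
      differentiableAt_of_contDiffOn hP.target.isOpen (hX i) (hP.mapsTo y hy)]
  set W : E n → E n := fun z => WithLp.toLp 2 (fun i => X i z) with hWdef
  set W' : E n → E n := fun z => WithLp.toLp 2 (fun i => X' i z) with hWdef'
  have hWW : ∀ z ∈ V, fderiv ℝ Φ z (W' z) = W (Φ z) := by
    intro z hz
    ext k
    have := congrFun (fderiv_apply_eq_jac_mulVec Φ z (W' z)) k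
    rw [this]
    exact congrFun (hXX z hz) k
  refine sum_apply_eq_of_conj (L' := fun c => fderiv ℝ W' y c + connForm G' y c (W' y))
    (L := fun c => fderiv ℝ W (Φ y) c + connForm G (Φ y) c (W (Φ y)))
    ⟨by intros; simp only [map_add, add_apply]; abel, by intros; simp⟩
    ⟨by intros; simp only [map_add, add_apply]; abel, by intros; simp⟩
    (hP.fderiv_injective hy) fun c => ?_
  have h1 := congrArg (fun L => L c) (fderiv_congr_of_isOpen hV hy hWW)
  have dW' := differentiableAt_of_contDiffOn hV hW' hy
  have d1 := differentiableAt_of_contDiffOn hV (contDiffOn_fderiv hV hP.smooth) hy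
  simp only [hP.fderiv_comp_apply hy hW, fderiv_clm_apply d1 dW', add_apply,
    ContinuousLinearMap.comp_apply, ContinuousLinearMap.flip_apply] at h1
  rw [map_add, hP.connForm_eq hy, hWW y hy, ← h1]
  abel

theorem lap_eq (hP : IsPullback Φ G' V G U) (hf : ContDiffOn ℝ ∞ f U)
    (hff : ∀ z ∈ V, f' z = f (Φ z)) (hy : y ∈ V) : lap G' f' y = lap G f (Φ y) :=
  hP.trace_eq hy (hP.hess_eq hf hff hy)

theorem locJ_eq (hP : IsPullback Φ G' V G U) (hy : y ∈ V) : locJ G' y = locJ G (Φ y) := by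
  rw [locJ, locJ, scalarCurv, hP.trace_eq hy (hP.ricci_eq hy), scalarCurv]

theorem schouten_eq (hP : IsPullback Φ G' V G U) (hy : y ∈ V) :
    Matrix.of (fun i j => schouten G' i j y) =
      (jac Φ y)ᵀ * Matrix.of (fun i j => schouten G i j (Φ y)) * jac Φ y := by
  have key : ∀ (G : E n → Matrix (Fin n) (Fin n) ℝ) (y : E n),
      Matrix.of (fun i j => schouten G i j y) = (1 / ((n : ℝ) - 2)) •
        (Matrix.of (fun i j => ricci G i j y) - locJ G y • G y) := by
    intro G y
    ext i j
    simp [schouten]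
  rw [key, key, hP.ricci_eq hy, hP.locJ_eq hy]
  conv_lhs => rw [hP.matrix_eq hy]
  simp only [Matrix.mul_smul, Matrix.smul_mul, Matrix.mul_sub, Matrix.sub_mul]

theorem locSigmaTwo_eq (hP : IsPullback Φ G' V G U) (hy : y ∈ V) :
    locSigmaTwo G' y = locSigmaTwo G (Φ y) := by
  rw [locSigmaTwo, locSigmaTwo, hP.locJ_eq hy,
    hP.contract_eq hy (hP.schouten_eq hy) (hP.schouten_eq hy)]

theorem locQ_eq (hP : IsPullback Φ G' V G U) (hy : y ∈ V) : locQ G' y = locQ G (Φ y) := by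
  rw [locQ, locQ, hP.locJ_eq hy, hP.contract_eq hy (hP.schouten_eq hy) (hP.schouten_eq hy),
    hP.lap_eq hP.target.locJ_smooth (fun z hz => hP.locJ_eq hz) hy]

theorem schoutenGrad_eq (hP : IsPullback Φ G' V G U) (hf : ContDiffOn ℝ ∞ f U)
    (hff : ∀ z ∈ V, f' z = f (Φ z)) (hy : y ∈ V) :
    jac Φ y *ᵥ (fun i => schoutenGrad G' f' i y) = (fun i => schoutenGrad G f i (Φ y)) :=
  hP.raise_eq hy (hP.schouten_eq hy) (hP.grad_eq hf hff hy)

theorem locP_eq (hP : IsPullback Φ G' V G U) (hf : ContDiffOn ℝ ∞ f U)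
    (hff : ∀ z ∈ V, f' z = f (Φ z)) (hy : y ∈ V) : locP G' f' y = locP G f (Φ y) := by
  have hfc : ContDiffOn ℝ ∞ f' V := (hP.contDiffOn_comp hf).congr hff
  have hX : ∀ {G : E n → Matrix (Fin n) (Fin n) ℝ} {U : Set (E n)} {f : E n → ℝ},
      IsMetricOn G U → ContDiffOn ℝ ∞ f U → ∀ i, ContDiffOn ℝ ∞
        (fun z => 4 * schoutenGrad G f i z - ((n : ℝ) - 2) * locJ G z * grad G f i z) U :=
    fun hG hf i => (contDiffOn_const.mul (hG.schoutenGrad_smooth hf i)).sub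
      ((contDiffOn_const.mul hG.locJ_smooth).mul (hG.grad_smooth hf i))
  rw [locP, locP, hff y hy, hP.locQ_eq hy,
    hP.lap_eq (hP.target.lap_smooth hf) (fun z hz => hP.lap_eq hf hff hz) hy,
    hP.divg_eq hy (hX hP.target hf) (hX hP.source hfc) fun z hz => ?_]
  have e1 : (fun i => 4 * schoutenGrad G' f' i z - ((n : ℝ) - 2) * locJ G' z * grad G' f' i z) =
      (4 : ℝ) • (fun i => schoutenGrad G' f' i z)
        - (((n : ℝ) - 2) * locJ G' z) • (fun i => grad G' f' i z) := by
    ext i; simp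
  rw [e1, Matrix.mulVec_sub, Matrix.mulVec_smul, Matrix.mulVec_smul,
    hP.schoutenGrad_eq hf hff hz, hP.grad_eq hf hff hz, hP.locJ_eq hz]
  ext i; simp

/-- Makes the operator on the manifold independent of the chart in which it is evaluated. -/
theorem locH_eq (hP : IsPullback Φ G' V G U) (hf : ContDiffOn ℝ ∞ f U)
    (hff : ∀ z ∈ V, f' z = f (Φ z)) (hy : y ∈ V) (lam : ℝ) :
    locH G' lam f' y = locH G lam f (Φ y) := by
  rw [locH, locH, hP.locP_eq hf hff hy, hP.locQ_eq hy, hff y hy, hP.locJ_eq hy,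
    hP.lap_eq hf hff hy, hP.contract_eq hy (hP.schouten_eq hy) (hP.hess_eq hf hff hy),
    hP.locSigmaTwo_eq hy]

end IsPullback

end

section

variable {n : ℕ} {U V : Set (E n)} {f h : E n → ℝ} {G G' : E n → Matrix (Fin n) (Fin n) ℝ}
  {y p : E n} {Φ : E n → E n}

/-! ### Coordinates in which the metric is Euclidean to first order at a point -/

/-- The vector field `D²f(∇h)`, with components `g^{ij} (D²f)_{jk} (∇h)^k`. -/
def hessGrad (G : E n → Matrix (Fin n) (Fin n) ℝ) (f h : E n → ℝ) (i : Fin n) (y : E n) : ℝ :=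
  ∑ j, ∑ k, (G y)⁻¹ i j * hess G f j k y * grad G h k y

theorem IsMetricOn.hessGrad_smooth (hG : IsMetricOn G U) (hf : ContDiffOn ℝ ∞ f U)
    (hh : ContDiffOn ℝ ∞ h U) (i : Fin n) : ContDiffOn ℝ ∞ (hessGrad G f h i) U :=
  ContDiffOn.sum fun j _ => ContDiffOn.sum fun k _ =>
    ((hG.inv_smooth i j).mul (hG.hess_smooth hf j k)).mul (hG.grad_smooth hh k)

/-- The metric `G` agrees with the Euclidean metric to first order at `p`. -/
structure IsNormalAt (G : E n → Matrix (Fin n) (Fin n) ℝ) (U : Set (E n)) (p : E n) : Prop where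
  metric : IsMetricOn G U
  mem : p ∈ U
  one : G p = 1
  pd_entry : ∀ i j k, pd k (fun z => G z i j) p = 0

namespace IsNormalAt

theorem inv_apply (hN : IsNormalAt G U p) (i j : Fin n) :
    (G p)⁻¹ i j = if i = j then 1 else 0 := by
  rw [hN.one, inv_one, Matrix.one_apply]

/-- Differentiate G⁻¹G = 1 at `p`, where G = 1 and the derivative of G vanishes. -/
theorem pd_inv (hN : IsNormalAt G U p) (i j k : Fin n) :
    pd k (fun z => (G z)⁻¹ i j) p = 0 := by
  have hU := hN.metric.isOpen
  have h1 : pd k (fun z => ∑ l, (G z)⁻¹ i l * G z l j) p = 0 := by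
    rw [pd_congr hU hN.mem (h := fun _ => (1 : Matrix (Fin n) (Fin n) ℝ) i j), pd_const]
    intro z hz
    rw [← Matrix.nonsing_inv_mul (G z) (hN.metric.isUnit_det hz), Matrix.mul_apply]
  rw [pd_sum _ hU (fun l => (hN.metric.inv_smooth i l).mul (hN.metric.smooth l j)) hN.mem] at h1
  simp only [fun l => pd_mul hU (hN.metric.inv_smooth i l) (hN.metric.smooth l j) hN.mem k,
    hN.pd_entry, hN.one, Matrix.one_apply] at h1
  simpa using h1

theorem sum_inv_mul (hN : IsNormalAt G U p) (a : Fin n → ℝ) (k : Fin n) :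
    ∑ l, (G p)⁻¹ k l * a l = a k := by
  simp [hN.inv_apply]

theorem pd_sum_inv_mul (hN : IsNormalAt G U p) {a : Fin n → E n → ℝ}
    (ha : ∀ l, ContDiffOn ℝ ∞ (a l) U) (k m : Fin n) :
    pd m (fun z => ∑ l, (G z)⁻¹ k l * a l z) p = pd m (a k) p := by
  have hU := hN.metric.isOpen
  rw [pd_sum _ hU (fun l => (hN.metric.inv_smooth k l).mul (ha l)) hN.mem]
  simp only [fun l => pd_mul hU (hN.metric.inv_smooth k l) (ha l) hN.mem m, hN.pd_inv, zero_mul,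
    zero_add]
  exact hN.sum_inv_mul _ k

/-- Second derivatives of the inverse metric need not vanish at `p`, but they multiply `a l p`. In
the application `a` consists of first derivatives of the metric, which do vanish there. -/
theorem pd_pd_sum_inv_mul (hN : IsNormalAt G U p) {a : Fin n → E n → ℝ}
    (ha : ∀ l, ContDiffOn ℝ ∞ (a l) U) (ha0 : ∀ l, a l p = 0) (k m r : Fin n) :
    pd m (pd r (fun z => ∑ l, (G z)⁻¹ k l * a l z)) p = pd m (pd r (a k)) p := by
  have hU := hN.metric.isOpen
  have hi := hN.metric.inv_smooth k
  have hi' := fun l => contDiffOn_pd hU (hi l) r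
  have ha' := fun l => contDiffOn_pd hU (ha l) r
  have h1 : ∀ z ∈ U, pd r (fun z => ∑ l, (G z)⁻¹ k l * a l z) z =
      ∑ l, pd r (fun z => (G z)⁻¹ k l) z * a l z + ∑ l, (G z)⁻¹ k l * pd r (a l) z := by
    intro z hz
    rw [pd_sum _ hU (fun l => (hi l).mul (ha l)) hz, ← Finset.sum_add_distrib]
    exact Finset.sum_congr rfl fun l _ => pd_mul hU (hi l) (ha l) hz r
  rw [pd_congr hU hN.mem h1, pd_add hU (ContDiffOn.sum fun l _ => (hi' l).mul (ha l))
    (ContDiffOn.sum fun l _ => (hi l).mul (ha' l)) hN.mem, hN.pd_sum_inv_mul ha',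
    pd_sum _ hU (fun l => (hi' l).mul (ha l)) hN.mem]
  simp [fun l => pd_mul hU (hi' l) (ha l) hN.mem m, hN.pd_inv, ha0]

theorem christoffel_eq_zero (hN : IsNormalAt G U p) (k i j : Fin n) :
    christoffel G k i j p = 0 := by
  simp [christoffel, hN.pd_entry]

theorem pd_christoffel (hN : IsNormalAt G U p) (m k i j : Fin n) :
    pd m (christoffel G k i j) p = (1 / 2) * (pd m (pd i fun z => G z j k) p
      + pd m (pd j fun z => G z i k) p - pd m (pd k fun z => G z i j) p) := by
  have hU := hN.metric.isOpen
  have hp : ∀ a b c, ContDiffOn ℝ ∞ (pd a fun z => G z b c) U :=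
    fun a b c => contDiffOn_pd hU (hN.metric.smooth b c) a
  have ha := fun l => ((hp i j l).add (hp j i l)).sub (hp l i j)
  have h1 := pd_const_mul hU (ContDiffOn.sum (s := Finset.univ) fun l _ =>
    (hN.metric.inv_smooth k l).mul (ha l)) hN.mem (1 / 2) m
  refine h1.trans ?_
  rw [hN.pd_sum_inv_mul ha, pd_sub hU ((hp i j k).add (hp j i k)) (hp k i j) hN.mem,
    pd_add hU (hp i j k) (hp j i k) hN.mem]

theorem pd_pd_christoffel (hN : IsNormalAt G U p) (m r k i j : Fin n) :
    pd m (pd r (christoffel G k i j)) p = (1 / 2) * (pd m (pd r (pd i fun z => G z j k)) p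
      + pd m (pd r (pd j fun z => G z i k)) p - pd m (pd r (pd k fun z => G z i j)) p) := by
  have hU := hN.metric.isOpen
  have hp : ∀ a b c, ContDiffOn ℝ ∞ (pd a fun z => G z b c) U :=
    fun a b c => contDiffOn_pd hU (hN.metric.smooth b c) a
  have hpp : ∀ d a b c, ContDiffOn ℝ ∞ (pd d (pd a fun z => G z b c)) U :=
    fun d a b c => contDiffOn_pd hU (hp a b c) d
  have ha := fun l => ((hp i j l).add (hp j i l)).sub (hp l i j)
  have hs := ContDiffOn.sum (s := Finset.univ) fun l _ => (hN.metric.inv_smooth k l).mul (ha l)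
  have h1 : ∀ z ∈ U, pd r (christoffel G k i j) z = _ :=
    fun z hz => pd_const_mul hU hs hz (1 / 2) r
  rw [pd_congr hU hN.mem h1, pd_const_mul hU (contDiffOn_pd hU hs r) hN.mem,
    hN.pd_pd_sum_inv_mul ha (fun l => by simp [hN.pd_entry])]
  have h2 : ∀ z ∈ U, pd r (fun z => pd i (fun z => G z j k) z + pd j (fun z => G z i k) z
      - pd k (fun z => G z i j) z) z = pd r (pd i fun z => G z j k) z
        + pd r (pd j fun z => G z i k) z - pd r (pd k fun z => G z i j) z := by
    intro z hz
    rw [pd_sub hU ((hp i j k).add (hp j i k)) (hp k i j) hz, pd_add hU (hp i j k) (hp j i k) hz]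
  rw [pd_congr hU hN.mem h2, pd_sub hU ((hpp r i j k).add (hpp r j i k)) (hpp r k i j) hN.mem,
    pd_add hU (hpp r i j k) (hpp r j i k) hN.mem]

theorem ricci_eq (hN : IsNormalAt G U p) (i j : Fin n) :
    ricci G i j p = ∑ k, (pd k (christoffel G k i j) p - pd j (christoffel G k i k) p) := by
  simp [ricci, hN.christoffel_eq_zero]

/-- The products of Christoffel symbols vanish to second order at `p`, so only the linear part of
Ricci contributes. -/
theorem pd_ricci (hN : IsNormalAt G U p) (m i j : Fin n) :
    pd m (ricci G i j) p = ∑ k, (pd m (pd k (christoffel G k i j)) p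
      - pd m (pd j (christoffel G k i k)) p) := by
  have hU := hN.metric.isOpen
  have hc := hN.metric.christoffel_smooth
  have hp : ∀ a k i j, ContDiffOn ℝ ∞ (pd a (christoffel G k i j)) U :=
    fun a k i j => contDiffOn_pd hU (hc k i j) a
  have hq : ∀ k l, ContDiffOn ℝ ∞ (fun y => christoffel G k k l y * christoffel G l i j y -
      christoffel G k j l y * christoffel G l i k y) U :=
    fun k l => ((hc _ _ _).mul (hc _ _ _)).sub ((hc _ _ _).mul (hc _ _ _))
  have h1 := pd_add hU (ContDiffOn.sum (s := Finset.univ) fun k _ => (hp k k i j).sub (hp j k i k))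
    (ContDiffOn.sum (s := Finset.univ) fun k _ => ContDiffOn.sum (s := Finset.univ)
      fun l _ => hq k l) hN.mem m
  refine h1.trans ?_
  rw [pd_sum _ hU (fun k => (hp k k i j).sub (hp j k i k)) hN.mem,
    pd_sum _ hU (fun k => ContDiffOn.sum (s := Finset.univ) fun l _ => hq k l) hN.mem]
  have h2 : ∀ k, pd m (fun z => ∑ l, (christoffel G k k l z * christoffel G l i j z -
      christoffel G k j l z * christoffel G l i k z)) p = 0 := by
    intro k
    rw [pd_sum _ hU (fun l => hq k l) hN.mem]
    refine Finset.sum_eq_zero fun l _ => ?_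
    rw [pd_sub hU ((hc _ _ _).mul (hc _ _ _)) ((hc _ _ _).mul (hc _ _ _)) hN.mem,
      pd_mul hU (hc _ _ _) (hc _ _ _) hN.mem, pd_mul hU (hc _ _ _) (hc _ _ _) hN.mem]
    simp [hN.christoffel_eq_zero]
  simp only [h2, Finset.sum_const_zero, add_zero]
  exact Finset.sum_congr rfl fun k _ => pd_sub hU (hp k k i j) (hp j k i k) hN.mem m

/-- The algebraic part of the contracted second Bianchi identity; `T a b c i k` stands for
`∂_a ∂_b ∂_c g_{ik}`. -/
theorem sum_third_derivatives {T : Fin n → Fin n → Fin n → Fin n → Fin n → ℝ}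
    (c12 : ∀ a b c i k, T a b c i k = T b a c i k) (c23 : ∀ a b c i k, T a b c i k = T a c b i k)
    (cs : ∀ a b c i k, T a b c i k = T a b c k i) (j : Fin n) :
    ∑ i, ∑ k, ((1 / 2) * (T j k i i k + T j k i i k - T j k k i i)
        - (1 / 2) * (T j i i k k + T j i k i k - T j i k i k)) =
      2 * ∑ i, ∑ k, ((1 / 2) * (T i k i j k + T i k j i k - T i k k i j)
        - (1 / 2) * (T i j i k k + T i j k i k - T i j k i k)) := by
  -- The terms with the free index `j` on the metric cancel, and both sides reduce to the sum of
  -- ∂_j∂_k∂_i g_{ik} minus that of ∂_j∂_i∂_i g_{kk}.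
  have h1 : ∑ i, ∑ k, T i k i j k = ∑ i, ∑ k, T i k k i j := by
    rw [Finset.sum_comm]
    refine Finset.sum_congr rfl fun i _ => Finset.sum_congr rfl fun k _ => ?_
    rw [c12, cs]
  have h2 : ∑ i, ∑ k, T j k k i i = ∑ i, ∑ k, T j i i k k := Finset.sum_comm
  have h3 : ∀ i k, T i k j i k = T j k i i k := fun i k => by
    rw [c23, c12, c23]
  have h4 : ∀ i k, T i j i k k = T j i i k k := fun i k => c12 _ _ _ _ _
  simp only [h3, h4, mul_add, mul_sub, Finset.sum_add_distrib, Finset.sum_sub_distrib,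
    ← Finset.mul_sum, h1, h2]
  ring

theorem pd_scalarCurv (hN : IsNormalAt G U p) (m : Fin n) :
    pd m (scalarCurv G) p = ∑ i, pd m (ricci G i i) p := by
  have hU := hN.metric.isOpen
  have h1 := pd_sum Finset.univ (F := fun i z => ∑ j, (G z)⁻¹ i j * ricci G i j z) hU
    (fun i => ContDiffOn.sum fun j _ => (hN.metric.inv_smooth i j).mul (hN.metric.ricci_smooth i j))
    hN.mem m
  refine h1.trans (Finset.sum_congr rfl fun i _ => ?_)
  exact hN.pd_sum_inv_mul (hN.metric.ricci_smooth i) i m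

/-- The contracted second Bianchi identity `∇_j R = 2 ∇^i Rc_{ij}`. -/
theorem pd_scalarCurv_eq_two_mul (hN : IsNormalAt G U p) (j : Fin n) :
    pd j (scalarCurv G) p = 2 * ∑ i, pd i (ricci G i j) p := by
  have hU := hN.metric.isOpen
  have hp : ∀ a b c, ContDiffOn ℝ ∞ (pd a fun z => G z b c) U :=
    fun a b c => contDiffOn_pd hU (hN.metric.smooth b c) a
  have c12 : ∀ a b c i k, pd a (pd b (pd c fun z => G z i k)) p =
      pd b (pd a (pd c fun z => G z i k)) p := fun a b c i k => pd_comm hU (hp c i k) hN.mem a b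
  have c23 : ∀ a b c i k, pd a (pd b (pd c fun z => G z i k)) p =
      pd a (pd c (pd b fun z => G z i k)) p := fun a b c i k =>
    pd_congr hU hN.mem (fun z hz => pd_comm hU (hN.metric.smooth i k) hz b c) a
  have cs : ∀ a b c i k, pd a (pd b (pd c fun z => G z i k)) p =
      pd a (pd b (pd c fun z => G z k i)) p := fun a b c i k =>
    pd_congr hU hN.mem (fun z hz => pd_congr hU hz (fun w hw => pd_congr hU hw
      (fun x hx => hN.metric.symm hx i k) c) b) a
  rw [hN.pd_scalarCurv]
  simp only [hN.pd_ricci, hN.pd_pd_christoffel]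
  exact sum_third_derivatives c12 c23 cs j

theorem divg_eq (hN : IsNormalAt G U p) (X : Fin n → E n → ℝ) :
    divg G X p = ∑ i, pd i (X i) p := by
  simp [divg, hN.christoffel_eq_zero]

theorem grad_eq (hN : IsNormalAt G U p) (h : E n → ℝ) (i : Fin n) : grad G h i p = pd i h p :=
  hN.sum_inv_mul _ i

theorem pd_grad (hN : IsNormalAt G U p) (hh : ContDiffOn ℝ ∞ h U) (i k : Fin n) :
    pd i (grad G h k) p = pd i (pd k h) p :=
  hN.pd_sum_inv_mul (fun l => contDiffOn_pd hN.metric.isOpen hh l) k i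

theorem hess_eq (hN : IsNormalAt G U p) (h : E n → ℝ) (i k : Fin n) :
    hess G h i k p = pd i (pd k h) p := by
  simp [hess, hN.christoffel_eq_zero]

theorem lap_eq (hN : IsNormalAt G U p) (h : E n → ℝ) : lap G h p = ∑ i, pd i (pd i h) p := by
  simp only [lap, hN.sum_inv_mul, hN.hess_eq]

theorem contract_eq (hN : IsNormalAt G U p) (S T : Fin n → Fin n → ℝ) :
    contract G S T p = ∑ i, ∑ j, S i j * T i j := by
  simp only [contract, hN.inv_apply]
  simp

/-- At `p` the inverse metric is the identity with zero derivative, so raising the index commutes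
with differentiation. -/
theorem pd_raise (hN : IsNormalAt G U p) {S : Fin n → Fin n → E n → ℝ} {v : Fin n → E n → ℝ}
    (hS : ∀ i j, ContDiffOn ℝ ∞ (S i j) U) (hv : ∀ i, ContDiffOn ℝ ∞ (v i) U) (m i : Fin n) :
    pd m (fun z => ∑ j, ∑ k, (G z)⁻¹ i j * S j k z * v k z) p =
      ∑ k, (pd m (S i k) p * v k p + S i k p * pd m (v k) p) := by
  have hU := hN.metric.isOpen
  have h1 : ∀ z ∈ U, ∑ j, ∑ k, (G z)⁻¹ i j * S j k z * v k z =
      ∑ j, (G z)⁻¹ i j * ∑ k, S j k z * v k z := by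
    intro z _
    simp only [Finset.mul_sum, mul_assoc]
  rw [pd_congr hU hN.mem h1, hN.pd_sum_inv_mul (a := fun j z => ∑ k, S j k z * v k z)
    (fun j => ContDiffOn.sum fun k _ => (hS j k).mul (hv k)),
    pd_sum _ hU (fun k => (hS i k).mul (hv k)) hN.mem]
  exact Finset.sum_congr rfl fun k _ => pd_mul hU (hS i k) (hv k) hN.mem m

theorem divg_grad (hN : IsNormalAt G U p) (hh : ContDiffOn ℝ ∞ h U) :
    divg G (grad G h) p = lap G h p := by
  simp only [hN.divg_eq, hN.lap_eq, hN.pd_grad hh]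

theorem pd_locJ (hN : IsNormalAt G U p) (j : Fin n) :
    pd j (locJ G) p = pd j (scalarCurv G) p / (2 * ((n : ℝ) - 1)) := by
  have h1 := pd_const_mul hN.metric.isOpen hN.metric.scalarCurv_smooth hN.mem
    (2 * ((n : ℝ) - 1))⁻¹ j
  rw [div_eq_inv_mul, ← h1]
  congr 1
  ext z
  rw [locJ, div_eq_inv_mul]

/-- This is div A = dJ. Bianchi gives div Rc = dR/2 = (n - 1) dJ; subtracting div(Jg) = dJ leaves (n
- 2) dJ, which the factor 1/(n - 2) normalises. -/
theorem sum_pd_schouten (hN : IsNormalAt G U p) (hn : 2 < n) (j : Fin n) :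
    ∑ i, pd i (schouten G i j) p = pd j (locJ G) p := by
  have hU := hN.metric.isOpen
  have h1 : ∀ i, pd i (schouten G i j) p = (1 / ((n : ℝ) - 2)) *
      (pd i (ricci G i j) p - if i = j then pd i (locJ G) p else 0) := by
    intro i
    have hJ := hN.metric.locJ_smooth
    have hR := hN.metric.ricci_smooth i j
    refine (pd_const_mul hU (hR.sub (hJ.mul (hN.metric.smooth i j))) hN.mem _ i).trans ?_
    rw [pd_sub hU hR (hJ.mul (hN.metric.smooth i j)) hN.mem,
      pd_mul hU hJ (hN.metric.smooth i j) hN.mem, hN.pd_entry, hN.one, Matrix.one_apply]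
    simp
  have h2 := hN.pd_scalarCurv_eq_two_mul j
  have h3 := hN.pd_locJ j
  have hn' : (2 : ℝ) < n := by exact_mod_cast hn
  have hn1 : (n : ℝ) - 1 ≠ 0 := by linarith
  have hn2 : (n : ℝ) - 2 ≠ 0 := by linarith
  simp only [h1, ← Finset.mul_sum, Finset.sum_sub_distrib, Finset.sum_ite_eq', Finset.mem_univ,
    if_true]
  rw [h2] at h3
  rw [h3]
  field_simp
  ring

/-- Product rule together with div A = dJ. Its use is to write JΔf - ⟨A, D²f⟩ as the divergence of
J∇f - A∇f. -/
theorem divg_schoutenGrad (hN : IsNormalAt G U p) (hn : 2 < n) (hf : ContDiffOn ℝ ∞ f U) :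
    divg G (schoutenGrad G f) p =
      contract G (fun i j => schouten G i j p) (fun i j => hess G f i j p) p
        + ∑ i, pd i (locJ G) p * grad G f i p := by
  rw [hN.divg_eq, hN.contract_eq]
  have h1 : ∀ i, pd i (schoutenGrad G f i) p = _ := fun i =>
    hN.pd_raise hN.metric.schouten_smooth (fun k => hN.metric.grad_smooth hf k) i i
  simp only [h1, hN.grad_eq, hN.pd_grad hf, hN.hess_eq, Finset.sum_add_distrib,
    ← hN.sum_pd_schouten hn, Finset.sum_mul]
  rw [add_comm, Finset.sum_comm (f := fun i k => pd i (schouten G i k) p * pd k f p)]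

theorem pd_hess (hN : IsNormalAt G U p) (hf : ContDiffOn ℝ ∞ f U) (m i j : Fin n) :
    pd m (hess G f i j) p = pd m (pd i (pd j f)) p
      - ∑ l, pd m (christoffel G l i j) p * pd l f p := by
  have hU := hN.metric.isOpen
  have hc := fun l => hN.metric.christoffel_smooth l i j
  have hp := fun l => contDiffOn_pd hU hf l
  refine (pd_sub hU (contDiffOn_pd hU (hp j) i) (ContDiffOn.sum fun l _ =>
    (hc l).mul (hp l)) hN.mem m).trans ?_
  rw [pd_sum _ hU (fun l => (hc l).mul (hp l)) hN.mem]
  congr 1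
  refine Finset.sum_congr rfl fun l _ => ?_
  rw [pd_mul hU (hc l) (hp l) hN.mem, hN.christoffel_eq_zero]
  ring

theorem pd_lap (hN : IsNormalAt G U p) (hf : ContDiffOn ℝ ∞ f U) (m : Fin n) :
    pd m (lap G f) p = ∑ i, pd m (hess G f i i) p := by
  have hU := hN.metric.isOpen
  have h1 := pd_sum Finset.univ (F := fun i z => ∑ j, (G z)⁻¹ i j * hess G f i j z) hU
    (fun i => ContDiffOn.sum fun j _ => (hN.metric.inv_smooth i j).mul
      (hN.metric.hess_smooth hf i j)) hN.mem m
  refine h1.trans (Finset.sum_congr rfl fun i _ => ?_)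
  exact hN.pd_sum_inv_mul (hN.metric.hess_smooth hf i) i m

/-- Commuting covariant derivatives: `∇^i (D²f)_{ik} = ∇_k Δf + Rc_{kl} ∇^l f`. -/
theorem sum_pd_hess (hN : IsNormalAt G U p) (hf : ContDiffOn ℝ ∞ f U) (k : Fin n) :
    ∑ i, pd i (hess G f i k) p = pd k (lap G f) p + ∑ l, ricci G k l p * pd l f p := by
  have hU := hN.metric.isOpen
  have c3 : ∀ i, pd i (pd i (pd k f)) p = pd k (pd i (pd i f)) p := by
    intro i
    rw [pd_congr hU hN.mem (fun z hz => pd_comm hU hf hz i k),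
      pd_comm hU (contDiffOn_pd hU hf i) hN.mem]
  have c12 : ∀ a b i j, pd a (pd b fun z => G z i j) p = pd b (pd a fun z => G z i j) p :=
    fun a b i j => pd_comm hU (hN.metric.smooth i j) hN.mem a b
  have cs : ∀ a b i j, pd a (pd b fun z => G z i j) p = pd a (pd b fun z => G z j i) p :=
    fun a b i j => pd_congr hU hN.mem (fun z hz => pd_congr hU hz
      (fun w hw => hN.metric.symm hw i j) b) a
  -- The left side arises from commuting derivatives, the right side from the definition of Ricci.
  -- Their equality is the pair symmetry of the curvature tensor, visible once Γ is written through
  -- second derivatives of the metric.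
  have key : ∀ i l, pd k (christoffel G l i i) p - pd i (christoffel G l i k) p =
      pd i (christoffel G i k l) p - pd l (christoffel G i k i) p := by
    intro i l
    simp only [hN.pd_christoffel]
    rw [c12 k i i l, c12 k l i i, cs i k l i, cs i l k i]
    ring
  have hR : ∑ l, ricci G k l p * pd l f p = ∑ i, ∑ l,
      (pd k (christoffel G l i i) p * pd l f p - pd i (christoffel G l i k) p * pd l f p) := by
    rw [Finset.sum_comm]
    refine Finset.sum_congr rfl fun l _ => ?_
    rw [hN.ricci_eq, Finset.sum_mul]
    refine Finset.sum_congr rfl fun i _ => ?_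
    rw [← key]; ring
  rw [hN.pd_lap hf, hR]
  simp only [hN.pd_hess hf, Finset.sum_sub_distrib, c3]
  ring

/-- The polarised Bochner formula in divergence form: the product rule, with the divergence of the
Hessian given by `sum_pd_hess`. -/
theorem divg_hessGrad (hN : IsNormalAt G U p) (hf : ContDiffOn ℝ ∞ f U)
    (hh : ContDiffOn ℝ ∞ h U) :
    divg G (hessGrad G f h) p =
      contract G (fun i j => hess G f i j p) (fun i j => hess G h i j p) p
        + ∑ i, pd i (lap G f) p * grad G h i p
        + ∑ i, ∑ j, ricci G i j p * grad G h i p * grad G f j p := by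
  rw [hN.divg_eq, hN.contract_eq]
  have h1 : ∀ i, pd i (hessGrad G f h i) p = _ := fun i =>
    hN.pd_raise (hN.metric.hess_smooth hf) (fun k => hN.metric.grad_smooth hh k) i i
  simp only [h1, hN.grad_eq, hN.pd_grad hh, Finset.sum_add_distrib]
  rw [Finset.sum_comm (f := fun i k => pd i (hess G f i k) p * pd k h p)]
  simp only [← Finset.sum_mul, hN.sum_pd_hess hf, add_mul, Finset.sum_add_distrib]
  have h2 : ∀ i j, ricci G i j p * pd i h p * pd j f p = ricci G i j p * pd j f p * pd i h p :=
    fun i j => by ring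
  simp only [Finset.sum_mul, hN.hess_eq, h2]
  ring

end IsNormalAt

end

/-! ### Existence of such coordinates and transfer of the identities -/

section

variable {n : ℕ} {U V : Set (E n)} {f h f' h' : E n → ℝ} {G G' : E n → Matrix (Fin n) (Fin n) ℝ}
  {y p : E n} {Φ : E n → E n}

section
open scoped MatrixOrder Matrix.Norms.L2Operator

/-- Factor A = CᵀC with C invertible and take B = C⁻¹. -/
theorem exists_transpose_mul_mul_eq_one {A : Matrix (Fin n) (Fin n) ℝ} (hA : A.PosDef) :
    ∃ B : Matrix (Fin n) (Fin n) ℝ, Bᵀ * A * B = 1 := by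
  obtain ⟨C, hC, rfl⟩ := CStarAlgebra.isStrictlyPositive_iff_eq_star_mul_self.mp
    hA.isStrictlyPositive
  have hu : IsUnit C.det := (Matrix.isUnit_iff_isUnit_det C).1 hC
  have hu' : IsUnit (Cᵀ).det := by rwa [Matrix.det_transpose]
  refine ⟨C⁻¹, ?_⟩
  rw [Matrix.star_eq_conjTranspose, Matrix.conjTranspose_eq_transpose_of_trivial,
    Matrix.transpose_nonsing_inv, ← Matrix.mul_assoc, Matrix.nonsing_inv_mul _ hu', Matrix.one_mul,
    Matrix.mul_nonsing_inv _ hu]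

end

/-- The metric is parallel. -/
theorem IsMetricOn.fderiv_metricForm (hG : IsMetricOn G U) (hy : y ∈ U) (c a b : E n) :
    fderiv ℝ (metricForm G) y c a b =
      metricForm G y (connForm G y c a) b + metricForm G y a (connForm G y c b) := by
  have h1 := hG.koszul hy c a b
  have h2 := hG.koszul hy c b a
  rw [hG.metricForm_symm hy a]
  rw [hG.fderiv_metricForm_symm hy c b a, hG.fderiv_metricForm_symm hy b c a] at h2
  rw [hG.fderiv_metricForm_symm hy a c b] at h1
  rw [hG.fderiv_metricForm_symm hy a c b, hG.fderiv_metricForm_symm hy b a c] at h2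
  linarith

theorem contDiffOn_jac (hV : IsOpen V) (hΦ : ContDiffOn ℝ ∞ Φ V) (k i : Fin n) :
    ContDiffOn ℝ ∞ (fun y => jac Φ y k i) V :=
  (contDiffOn_piLp 2).1 ((contDiffOn_fderiv hV hΦ).clm_apply contDiffOn_const) k

/-- A smooth map with invertible derivative pulls a metric back to a metric. -/
theorem IsMetricOn.isPullback (hG : IsMetricOn G U) (hV : IsOpen V) (hΦ : ContDiffOn ℝ ∞ Φ V)
    (hm : ∀ z ∈ V, Φ z ∈ U) (hd : ∀ z ∈ V, (jac Φ z).det ≠ 0) :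
    IsPullback Φ (fun z => (jac Φ z)ᵀ * G (Φ z) * jac Φ z) V G U where
  source :=
    { isOpen := hV
      smooth := fun i j => by
        simp only [Matrix.mul_apply, Matrix.transpose_apply]
        exact ContDiffOn.sum fun l _ => (ContDiffOn.sum fun k _ =>
          (contDiffOn_jac hV hΦ k i).mul ((hG.smooth k l).comp hΦ hm)).mul
            (contDiffOn_jac hV hΦ l j)
      posDef := fun z hz => by
        have := (hG.posDef _ (hm z hz)).conjTranspose_mul_mul_same (B := jac Φ z)
          (Matrix.mulVec_injective_of_isUnit
            ((Matrix.isUnit_iff_isUnit_det _).2 (hd z hz).isUnit))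
        rwa [Matrix.conjTranspose_eq_transpose_of_trivial] at this }
  target := hG
  smooth := hΦ
  mapsTo := hm
  entry := fun z hz i j => by
    rw [bilinear_eq_jac (B := fun a b => metricForm G (Φ z) a b)
      (fun v => ⟨by simp, by simp⟩) (fun v => ⟨by simp, by simp⟩)]
    simp only [metricForm_stdVec]
    rfl

/-- Around every point there are coordinates in which the metric is Euclidean to first order. -/
theorem IsMetricOn.exists_isNormalAt (hG : IsMetricOn G U) (hp : p ∈ U) :
    ∃ (Φ : E n → E n) (G' : E n → Matrix (Fin n) (Fin n) ℝ) (V : Set (E n)) (z : E n),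
      IsPullback Φ G' V G U ∧ IsNormalAt G' V z ∧ Φ z = p := by
  obtain ⟨B, hB⟩ := exists_transpose_mul_mul_eq_one (hG.posDef p hp)
  let L : E n →L[ℝ] E n := Matrix.toEuclideanCLM (𝕜 := ℝ) B
  let C := connForm G p
  -- `L` sends the standard basis to a basis orthonormal for `G p`. The quadratic term makes D²Φ(0)
  -- = -Γ(L·, L·), which cancels the Christoffel term in the transformation law at the origin.
  let Φ : E n → E n := fun z => p + L z - (1 / 2 : ℝ) • C (L z) (L z)
  have hΦ : ContDiff ℝ ∞ Φ := by fun_prop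
  have hd1 : ∀ z a, fderiv ℝ Φ z a = L a - C (L z) (L a) := by
    intro z a
    have e1 : fderiv ℝ (fun z => C (L z) (L z)) z a = C (L a) (L z) + C (L z) (L a) := by
      rw [fderiv_apply₂ (F := fun _ => C) (by fun_prop) (by fun_prop) (by fun_prop)]
      simp
    have e2 : fderiv ℝ Φ z a = L a - (1 / 2 : ℝ) • fderiv ℝ (fun z => C (L z) (L z)) z a := by
      simp only [Φ]
      rw [fderiv_fun_sub (by fun_prop) (by fun_prop), fderiv_const_add, fderiv_fun_const_smul
        (by fun_prop)]
      simp
    rw [e2, e1, hG.connForm_symm hp (L a) (L z), ← two_smul ℝ, smul_smul]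
    norm_num [C]
  have hd2 : ∀ a c, fderiv ℝ (fderiv ℝ Φ) 0 c a = - C (L c) (L a) := by
    intro a c
    rw [← fderiv_fderiv_apply isOpen_univ hΦ.contDiffOn (Set.mem_univ _)]
    simp only [hd1]
    rw [fderiv_const_sub, neg_apply,
      fderiv_apply₂ (F := fun _ => C) (by fun_prop) (by fun_prop) (by fun_prop)]
    simp
  have hΦ0 : Φ 0 = p := by simp [Φ]
  have hL : fderiv ℝ Φ 0 = L := by ext1 a; rw [hd1]; simp
  have hJ : jac Φ 0 = B := by
    ext k i
    simp [jac, hL, L]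
  have hjs : ∀ k i, ContDiff ℝ ∞ (fun z => jac Φ z k i) := fun k i =>
    contDiffOn_univ.1 (contDiffOn_jac isOpen_univ hΦ.contDiffOn k i)
  have hdet : Continuous fun z => (jac Φ z).det :=
    (contDiffOn_univ.1 (contDiffOn_det fun k i => (hjs k i).contDiffOn)).continuous
  -- `Φ` is defined on all of ℝⁿ but lands in `U` with invertible derivative only near the origin.
  let V : Set (E n) := Φ ⁻¹' U ∩ {z | (jac Φ z).det ≠ 0}
  have hV : IsOpen V := (hG.isOpen.preimage hΦ.continuous).inter (isOpen_ne.preimage hdet)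
  have hP := hG.isPullback hV hΦ.contDiffOn (fun z hz => hz.1) (fun z hz => hz.2)
  have h0 : (0 : E n) ∈ V := by
    refine ⟨by simpa [hΦ0] using hp, ?_⟩
    intro h
    have := congrArg Matrix.det hB
    rw [hJ] at h
    simp [h] at this
  refine ⟨Φ, _, V, 0, hP, ⟨hP.source, h0, ?_, ?_⟩, hΦ0⟩
  · simp only [hJ, hΦ0, hB]
  · intro i j k
    -- The pulled-back connection vanishes at the origin; since the metric is parallel, so do the
    -- first derivatives of its entries.
    have hC : ∀ a b, connForm (fun z => (jac Φ z)ᵀ * G (Φ z) * jac Φ z) 0 a b = 0 := by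
      intro a b
      apply hP.fderiv_injective h0
      rw [hP.connForm_eq h0, hd2, hL, hΦ0, map_zero]
      simp [C]
    rw [hP.source.pd_entry h0, hP.source.fderiv_metricForm h0, hC, hC]
    simp

/-- Both sides are invariant under pullback, so it suffices to compare them in coordinates that are
Euclidean to first order at the given point. The identities for `schoutenGrad` and `hessGrad` are
transferred in the same way. -/
theorem IsMetricOn.divg_grad (hG : IsMetricOn G U) (hh : ContDiffOn ℝ ∞ h U) (hy : y ∈ U) :
    divg G (grad G h) y = lap G h y := by
  obtain ⟨Φ, G', V, z, hP, hN, rfl⟩ := hG.exists_isNormalAt hy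
  have hh' := hP.contDiffOn_comp hh
  rw [← hP.lap_eq hh (fun _ _ => rfl) hN.mem, ← hN.divg_grad hh']
  exact (hP.divg_eq hN.mem (hG.grad_smooth hh) (hP.source.grad_smooth hh')
    fun w hw => hP.grad_eq hh (fun _ _ => rfl) hw).symm

theorem IsMetricOn.divg_schoutenGrad (hG : IsMetricOn G U) (hn : 2 < n)
    (hf : ContDiffOn ℝ ∞ f U) (hy : y ∈ U) :
    divg G (schoutenGrad G f) y =
      contract G (fun i j => schouten G i j y) (fun i j => hess G f i j y) y
        + ∑ i, pd i (locJ G) y * grad G f i y := by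
  obtain ⟨Φ, G', V, z, hP, hN, rfl⟩ := hG.exists_isNormalAt hy
  have hf' := hP.contDiffOn_comp hf
  have h1 := hN.divg_schoutenGrad hn hf'
  rw [hP.divg_eq hN.mem (hG.schoutenGrad_smooth hf) (hP.source.schoutenGrad_smooth hf')
      fun w hw => hP.schoutenGrad_eq hf (fun _ _ => rfl) hw,
    hP.contract_eq hN.mem (hP.schouten_eq hN.mem) (hP.hess_eq hf (fun _ _ => rfl) hN.mem),
    hP.sum_pd_mul_eq hG.locJ_smooth (fun w hw => hP.locJ_eq hw) hN.mem
      (hP.grad_eq hf (fun _ _ => rfl) hN.mem)] at h1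
  exact h1

theorem IsPullback.hessGrad_eq (hP : IsPullback Φ G' V G U) (hf : ContDiffOn ℝ ∞ f U)
    (hff : ∀ z ∈ V, f' z = f (Φ z)) (hh : ContDiffOn ℝ ∞ h U)
    (hhh : ∀ z ∈ V, h' z = h (Φ z)) (hy : y ∈ V) :
    jac Φ y *ᵥ (fun i => hessGrad G' f' h' i y) = (fun i => hessGrad G f h i (Φ y)) :=
  hP.raise_eq hy (hP.hess_eq hf hff hy) (hP.grad_eq hh hhh hy)

theorem sum_tensor_mul_eq {S S' : Fin n → Fin n → ℝ}
    {v v' w w' : Fin n → ℝ} (hS : Matrix.of S' = (jac Φ y)ᵀ * Matrix.of S * jac Φ y)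
    (hv : jac Φ y *ᵥ v' = v) (hw : jac Φ y *ᵥ w' = w) :
    ∑ i, ∑ j, S' i j * v' i * w' j = ∑ i, ∑ j, S i j * v i * w j := by
  have key : ∀ (S : Fin n → Fin n → ℝ) (v w : Fin n → ℝ),
      ∑ i, ∑ j, S i j * v i * w j = v ⬝ᵥ (Matrix.of S *ᵥ w) := by
    intro S v w
    simp only [Matrix.mulVec, dotProduct, Finset.mul_sum, Matrix.of_apply]
    refine Finset.sum_congr rfl fun i _ => Finset.sum_congr rfl fun j _ => ?_
    ring
  rw [key, key, hS, ← hv, ← hw, Matrix.mul_assoc, ← Matrix.mulVec_mulVec, ← Matrix.mulVec_mulVec,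
    Matrix.dotProduct_mulVec, Matrix.vecMul_transpose]

theorem IsMetricOn.divg_hessGrad (hG : IsMetricOn G U) (hf : ContDiffOn ℝ ∞ f U)
    (hh : ContDiffOn ℝ ∞ h U) (hy : y ∈ U) :
    divg G (hessGrad G f h) y =
      contract G (fun i j => hess G f i j y) (fun i j => hess G h i j y) y
        + ∑ i, pd i (lap G f) y * grad G h i y
        + ∑ i, ∑ j, ricci G i j y * grad G h i y * grad G f j y := by
  obtain ⟨Φ, G', V, z, hP, hN, rfl⟩ := hG.exists_isNormalAt hy
  have hf' := hP.contDiffOn_comp hf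
  have hh' := hP.contDiffOn_comp hh
  have h1 := hN.divg_hessGrad hf' hh'
  have gf := hP.grad_eq hf (fun _ _ => rfl) hN.mem
  have gh := hP.grad_eq hh (fun _ _ => rfl) hN.mem
  rw [hP.divg_eq hN.mem (hG.hessGrad_smooth hf hh) (hP.source.hessGrad_smooth hf' hh')
      fun w hw => hP.hessGrad_eq hf (fun _ _ => rfl) hh (fun _ _ => rfl) hw,
    hP.contract_eq hN.mem (hP.hess_eq hf (fun _ _ => rfl) hN.mem)
      (hP.hess_eq hh (fun _ _ => rfl) hN.mem),
    hP.sum_pd_mul_eq (hG.lap_smooth hf) (fun w hw => hP.lap_eq hf (fun _ _ => rfl) hw) hN.mem gh,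
    sum_tensor_mul_eq (hP.ricci_eq hN.mem) gh gf] at h1
  exact h1

end

section

variable {n : ℕ} {U V K : Set (E n)} {f h f' h' u : E n → ℝ}
  {G G' : E n → Matrix (Fin n) (Fin n) ℝ} {X Y : Fin n → E n → ℝ}
  {y p : E n} {Φ : E n → E n}

/-! ### The quadratic form of `H` -/

theorem divg_add (hU : IsOpen U) (hX : ∀ i, ContDiffOn ℝ ∞ (X i) U)
    (hY : ∀ i, ContDiffOn ℝ ∞ (Y i) U) (hy : y ∈ U) :
    divg G (fun i z => X i z + Y i z) y = divg G X y + divg G Y y := by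
  simp only [divg, fun i => pd_add hU (hX i) (hY i) hy, mul_add, Finset.sum_add_distrib]
  ring

theorem divg_mul (hU : IsOpen U) (hu : ContDiffOn ℝ ∞ u U) (hX : ∀ i, ContDiffOn ℝ ∞ (X i) U)
    (hy : y ∈ U) :
    divg G (fun i z => u z * X i z) y = u y * divg G X y + ∑ i, pd i u y * X i y := by
  simp only [divg, fun i => pd_mul hU hu (hX i) hy, Finset.sum_add_distrib, mul_add,
    Finset.mul_sum]
  have : ∀ i j, christoffel G i i j y * (u y * X j y) = u y * (christoffel G i i j y * X j y) :=
    fun i j => by ring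
  simp only [this]
  ring

theorem divg_const_mul (hU : IsOpen U) (a : ℝ) (hX : ∀ i, ContDiffOn ℝ ∞ (X i) U)
    (hy : y ∈ U) : divg G (fun i z => a * X i z) y = a * divg G X y := by
  rw [divg_mul hU contDiffOn_const hX hy]
  simp [pd_const]

/-- The inner product `⟨∇f, ∇h⟩`. -/
def gradInner (G : E n → Matrix (Fin n) (Fin n) ℝ) (f h : E n → ℝ) (y : E n) : ℝ :=
  ∑ i, pd i f y * grad G h i y

/-- The symmetric bilinear form that represents `∫ Hf · h`. -/
def locB (G : E n → Matrix (Fin n) (Fin n) ℝ) (lam : ℝ) (f h : E n → ℝ) (y : E n) : ℝ :=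
  (1 - (4 - lam) / ((n : ℝ) - 2)) * (lap G f y * lap G h y)
    + (4 - lam) / ((n : ℝ) - 2) *
      contract G (fun i j => hess G f i j y) (fun i j => hess G h i j y) y
    + ((4 - lam) / ((n : ℝ) - 2) + n - 2 - lam) * (locJ G y * gradInner G f h y)
    + ((n : ℝ) - 4) / 2 * (locQ G y - lam * locSigmaTwo G y) * (f y * h y)

/-- The vector field whose divergence is the difference of `Hf · h` and the bilinear form. -/
def fluxField (G : E n → Matrix (Fin n) (Fin n) ℝ) (lam : ℝ) (f h : E n → ℝ) (i : Fin n)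
    (y : E n) : ℝ :=
  h y * (grad G (lap G f) i y + ((4 - lam) * schoutenGrad G f i y
      + (-((n : ℝ) - 2 - lam)) * (locJ G y * grad G f i y)))
    + ((-(1 - (4 - lam) / ((n : ℝ) - 2))) * (lap G f y * grad G h i y)
      + (-((4 - lam) / ((n : ℝ) - 2))) * hessGrad G f h i y)

namespace IsMetricOn

theorem gradInner_comm (hG : IsMetricOn G U) (hy : y ∈ U) (f h : E n → ℝ) :
    gradInner G f h y = gradInner G h f y := by
  simp only [gradInner, grad, Finset.mul_sum]
  rw [Finset.sum_comm]
  refine Finset.sum_congr rfl fun i _ => Finset.sum_congr rfl fun j _ => ?_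
  rw [hG.inv_symm hy]; ring

theorem sum_pd_mul_schoutenGrad (hG : IsMetricOn G U) (hy : y ∈ U) (f h : E n → ℝ) :
    ∑ i, pd i h y * schoutenGrad G f i y =
      ∑ i, ∑ j, schouten G i j y * grad G h i y * grad G f j y := by
  simp only [schoutenGrad, Finset.mul_sum]
  rw [Finset.sum_comm]
  refine Finset.sum_congr rfl fun i _ => ?_
  rw [Finset.sum_comm]
  refine Finset.sum_congr rfl fun k _ => ?_
  conv_rhs => rw [grad]
  rw [Finset.mul_sum, Finset.sum_mul]
  refine Finset.sum_congr rfl fun j _ => ?_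
  rw [hG.inv_symm hy]; ring

theorem sum_metric_grad_grad (hG : IsMetricOn G U) (hy : y ∈ U) (f h : E n → ℝ) :
    ∑ i, ∑ j, G y i j * grad G h i y * grad G f j y = gradInner G f h y := by
  rw [hG.gradInner_comm hy, gradInner, Finset.sum_comm]
  have h1 : (fun j => ∑ i, G y i j * grad G h i y) = fun j => pd j h y := by
    have h2 := congrArg (fun v => G y *ᵥ v) (grad_eq_mulVec G h y)
    simp only [Matrix.mulVec_mulVec, Matrix.mul_nonsing_inv _ (hG.isUnit_det hy),
      Matrix.one_mulVec] at h2
    rw [← h2]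
    ext j
    simp only [Matrix.mulVec, dotProduct]
    exact Finset.sum_congr rfl fun i _ => by rw [hG.symm hy]
  refine Finset.sum_congr rfl fun j _ => ?_
  rw [← congrFun h1 j, Finset.sum_mul]

/-- Rc = (n - 2)A + Jg, evaluated on two gradients; it converts the Ricci term of Bochner's formula
into the Schouten term to be eliminated. -/
theorem sum_ricci_grad_grad (hG : IsMetricOn G U) (hn : 2 < n) (hy : y ∈ U) (f h : E n → ℝ) :
    ∑ i, ∑ j, ricci G i j y * grad G h i y * grad G f j y =
      ((n : ℝ) - 2) * ∑ i, ∑ j, schouten G i j y * grad G h i y * grad G f j y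
        + locJ G y * gradInner G f h y := by
  have hn' : (2 : ℝ) < n := by exact_mod_cast hn
  have hn2 : (n : ℝ) - 2 ≠ 0 := by linarith
  rw [← hG.sum_metric_grad_grad hy, Finset.mul_sum, Finset.mul_sum, ← Finset.sum_add_distrib]
  refine Finset.sum_congr rfl fun i _ => ?_
  rw [Finset.mul_sum, Finset.mul_sum, ← Finset.sum_add_distrib]
  refine Finset.sum_congr rfl fun j _ => ?_
  rw [schouten]
  field_simp
  ring

theorem fluxField_smooth (hG : IsMetricOn G U) (hf : ContDiffOn ℝ ∞ f U)
    (hh : ContDiffOn ℝ ∞ h U) (lam : ℝ) (i : Fin n) :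
    ContDiffOn ℝ ∞ (fluxField G lam f h i) U :=
  (hh.mul ((hG.grad_smooth (hG.lap_smooth hf) i).add
    ((contDiffOn_const.mul (hG.schoutenGrad_smooth hf i)).add
      (contDiffOn_const.mul (hG.locJ_smooth.mul (hG.grad_smooth hf i)))))).add
    ((contDiffOn_const.mul ((hG.lap_smooth hf).mul (hG.grad_smooth hh i))).add
      (contDiffOn_const.mul (hG.hessGrad_smooth hf hh i)))

/-- The pointwise integration by parts. With t = (4 - lam)/(n - 2), the pairings ⟨∇Δf, ∇h⟩ in the
divergence occur with weights 1, -(1 - t) and -t and cancel. The term (4 - lam)A(∇f,∇h) cancels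
against the Schouten part of -t·Rc(∇f,∇h), because t(n - 2) = 4 - lam; this fixes the value of t. -/
theorem locH_mul_eq (hG : IsMetricOn G U) (hn : 2 < n) (hf : ContDiffOn ℝ ∞ f U)
    (hh : ContDiffOn ℝ ∞ h U) (lam : ℝ) (hy : y ∈ U) :
    locH G lam f y * h y = locB G lam f h y + divg G (fluxField G lam f h) y := by
  have hU := hG.isOpen
  have hL := hG.lap_smooth hf
  have hJ := hG.locJ_smooth
  have gL := hG.grad_smooth hL
  have gf := hG.grad_smooth hf
  have gh := hG.grad_smooth hh
  have sg := hG.schoutenGrad_smooth hf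
  have hg := hG.hessGrad_smooth hf hh
  have Jg := fun i => hJ.mul (gf i)
  have c1 : ∀ a i, ContDiffOn ℝ ∞ (fun z => a * schoutenGrad G f i z) U :=
    fun a i => contDiffOn_const.mul (sg i)
  have c2 : ∀ a i, ContDiffOn ℝ ∞ (fun z => a * (locJ G z * grad G f i z)) U :=
    fun a i => contDiffOn_const.mul (Jg i)
  have c3 : ∀ a i, ContDiffOn ℝ ∞ (fun z => a * (lap G f z * grad G h i z)) U :=
    fun a i => contDiffOn_const.mul (hL.mul (gh i))
  have c4 : ∀ a i, ContDiffOn ℝ ∞ (fun z => a * hessGrad G f h i z) U :=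
    fun a i => contDiffOn_const.mul (hg i)
  have e1 : divg G (fun i z => 4 * schoutenGrad G f i z
      - ((n : ℝ) - 2) * locJ G z * grad G f i z) y =
      divg G (fun i z => 4 * schoutenGrad G f i z
        + (-((n : ℝ) - 2)) * (locJ G z * grad G f i z)) y := by
    congr 1
    ext i z
    ring
  have eY : divg G (fluxField G lam f h) y = _ :=
    divg_add hU (fun i => hh.mul ((gL i).add ((c1 (4 - lam) i).add
      (c2 (-((n : ℝ) - 2 - lam)) i)))) (fun i =>
      (c3 (-(1 - (4 - lam) / ((n : ℝ) - 2))) i).add (c4 (-((4 - lam) / ((n : ℝ) - 2))) i)) hy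
  have hn' : (2 : ℝ) < n := by exact_mod_cast hn
  have hn2 : (n : ℝ) - 2 ≠ 0 := by linarith
  rw [eY, divg_mul hU hh (fun i => (gL i).add ((c1 (4 - lam) i).add
      (c2 (-((n : ℝ) - 2 - lam)) i))) hy,
    divg_add hU gL (fun i => (c1 (4 - lam) i).add (c2 (-((n : ℝ) - 2 - lam)) i)) hy,
    divg_add hU (c1 _) (c2 _) hy, divg_add hU (c3 _) (c4 _) hy,
    divg_const_mul hU _ sg hy, divg_const_mul hU _ Jg hy,
    divg_const_mul hU _ (fun i => hL.mul (gh i)) hy, divg_const_mul hU _ hg hy,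
    divg_mul hU hL gh hy, divg_mul hU hJ gf hy, hG.divg_grad hL hy, hG.divg_grad hh hy,
    hG.divg_grad hf hy, hG.divg_hessGrad hf hh hy, hG.divg_schoutenGrad hn hf hy,
    hG.sum_ricci_grad_grad hn hy, locH, locP, e1, divg_add hU (c1 _) (c2 _) hy,
    divg_const_mul hU _ sg hy, divg_const_mul hU _ Jg hy, divg_mul hU hJ gf hy,
    hG.divg_grad hf hy, hG.divg_schoutenGrad hn hf hy, locB]
  simp only [mul_add, Finset.sum_add_distrib]
  have s1 : ∑ i, pd i h y * ((4 - lam) * schoutenGrad G f i y) =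
      (4 - lam) * ∑ i, pd i h y * schoutenGrad G f i y := by
    rw [Finset.mul_sum]; exact Finset.sum_congr rfl fun i _ => by ring
  have s2 : ∑ i, pd i h y * ((-((n : ℝ) - 2 - lam)) * (locJ G y * grad G f i y)) =
      (-((n : ℝ) - 2 - lam)) * locJ G y * gradInner G f h y := by
    rw [hG.gradInner_comm hy, gradInner, Finset.mul_sum]
    exact Finset.sum_congr rfl fun i _ => by ring
  have s3 : ∑ i, pd i h y * grad G (lap G f) i y = gradInner G (lap G f) h y := by
    rw [hG.gradInner_comm hy, gradInner]
  have s4 : ∑ i, pd i (lap G f) y * grad G h i y = gradInner G (lap G f) h y := rfl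
  rw [s1, s2, s3, s4, hG.sum_pd_mul_schoutenGrad hy]
  field_simp
  ring

end IsMetricOn

end

/-! ### Symmetry, positivity and locality of the bilinear form -/

section

variable {n : ℕ} {U V K : Set (E n)} {f h f' h' u : E n → ℝ}
  {G G' : E n → Matrix (Fin n) (Fin n) ℝ} {X Y : Fin n → E n → ℝ}
  {y p : E n} {Φ : E n → E n}

namespace IsMetricOn

theorem contract_comm (hG : IsMetricOn G U) (hy : y ∈ U) (S T : Fin n → Fin n → ℝ) :
    contract G S T y = contract G T S y := by
  rw [contract_eq_trace, contract_eq_trace, ← Matrix.trace_transpose]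
  have hs : ((G y)⁻¹)ᵀ = (G y)⁻¹ := by ext i j; exact hG.inv_symm hy j i
  simp only [Matrix.transpose_mul, Matrix.transpose_transpose, hs]
  rw [Matrix.trace_mul_comm]
  simp only [Matrix.mul_assoc]

theorem locB_comm (hG : IsMetricOn G U) (hy : y ∈ U) (lam : ℝ) (f h : E n → ℝ) :
    locB G lam f h y = locB G lam h f y := by
  rw [locB, locB, hG.contract_comm hy, hG.gradInner_comm hy, mul_comm (lap G f y),
    mul_comm (f y)]

/-- In coordinates with `G = 1` at the point this is a sum of squares; the same holds for the
squared norm of the Hessian. -/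
theorem gradInner_self_nonneg (hG : IsMetricOn G U) (hf : ContDiffOn ℝ ∞ f U) (hy : y ∈ U) :
    0 ≤ gradInner G f f y := by
  obtain ⟨Φ, G', V, z, hP, hN, rfl⟩ := hG.exists_isNormalAt hy
  rw [gradInner, ← hP.sum_pd_mul_eq hf (fun _ _ => rfl) hN.mem
    (hP.grad_eq hf (fun _ _ => rfl) hN.mem)]
  refine Finset.sum_nonneg fun i _ => ?_
  rw [hN.grad_eq]
  exact mul_self_nonneg _

theorem contract_hess_self_nonneg (hG : IsMetricOn G U) (hf : ContDiffOn ℝ ∞ f U) (hy : y ∈ U) :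
    0 ≤ contract G (fun i j => hess G f i j y) (fun i j => hess G f i j y) y := by
  obtain ⟨Φ, G', V, z, hP, hN, rfl⟩ := hG.exists_isNormalAt hy
  rw [← hP.contract_eq hN.mem (hP.hess_eq hf (fun _ _ => rfl) hN.mem)
    (hP.hess_eq hf (fun _ _ => rfl) hN.mem), hN.contract_eq]
  exact Finset.sum_nonneg fun i _ => Finset.sum_nonneg fun j _ => mul_self_nonneg _

/-- All terms except the zeroth-order one are nonnegative: 0 ≤ 4 - lam ≤ 4 ≤ n - 2 puts the weights
of |D²f|² and (Δf)² in [0, 1], and n - 2 - lam ≥ 0 handles the gradient term, where J > 0 enters. -/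
theorem le_locB_self (hG : IsMetricOn G U) (hn : 6 ≤ n) {lam : ℝ} (h0 : 0 ≤ lam) (h4 : lam ≤ 4)
    (hf : ContDiffOn ℝ ∞ f U) (hy : y ∈ U) (hJ : 0 < locJ G y) :
    ((n : ℝ) - 4) / 2 * (locQ G y - lam * locSigmaTwo G y) * f y ^ 2 ≤ locB G lam f f y := by
  have hn' : (6 : ℝ) ≤ n := by exact_mod_cast hn
  have ht0 : 0 ≤ (4 - lam) / ((n : ℝ) - 2) := div_nonneg (by linarith) (by linarith)
  have ht1 : (4 - lam) / ((n : ℝ) - 2) ≤ 1 := by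
    rw [div_le_one (by linarith)]; linarith
  have h1 := mul_nonneg (sub_nonneg.2 ht1) (mul_self_nonneg (lap G f y))
  have h2 := mul_nonneg ht0 (hG.contract_hess_self_nonneg hf hy)
  have h3 : 0 ≤ ((4 - lam) / ((n : ℝ) - 2) + n - 2 - lam) * (locJ G y * gradInner G f f y) :=
    mul_nonneg (by linarith) (mul_nonneg hJ.le (hG.gradInner_self_nonneg hf hy))
  rw [locB, ← pow_two (f y)]
  linarith

theorem locB_smooth (hG : IsMetricOn G U) (hf : ContDiffOn ℝ ∞ f U) (hh : ContDiffOn ℝ ∞ h U)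
    (lam : ℝ) : ContDiffOn ℝ ∞ (locB G lam f h) U :=
  (((contDiffOn_const.mul ((hG.lap_smooth hf).mul (hG.lap_smooth hh))).add
    (contDiffOn_const.mul (hG.contract_smooth (hG.hess_smooth hf) (hG.hess_smooth hh)))).add
    (contDiffOn_const.mul (hG.locJ_smooth.mul (ContDiffOn.sum fun i _ =>
      (contDiffOn_pd hG.isOpen hf i).mul (hG.grad_smooth hh i))))).add
    ((contDiffOn_const.mul (hG.locQ_smooth.sub (contDiffOn_const.mul hG.locSigmaTwo_smooth))).mul
      (hf.mul hh))

/-- Additivity in the second argument is what allows that argument to be cut up by a partition of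
unity. -/
theorem locB_add (hG : IsMetricOn G U) (hh : ContDiffOn ℝ ∞ h U) (hu : ContDiffOn ℝ ∞ u U)
    (hy : y ∈ U) (lam : ℝ) (f : E n → ℝ) :
    locB G lam f (fun z => h z + u z) y = locB G lam f h y + locB G lam f u y := by
  have hU := hG.isOpen
  have e1 : ∀ i, pd i (fun z => h z + u z) y = pd i h y + pd i u y := pd_add hU hh hu hy
  have e2 : ∀ i j, hess G (fun z => h z + u z) i j y = hess G h i j y + hess G u i j y := by
    intro i j
    rw [hess, pd_congr hU hy (fun z hz => pd_add hU hh hu hz j),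
      pd_add hU (contDiffOn_pd hU hh j) (contDiffOn_pd hU hu j) hy]
    simp only [e1, mul_add, Finset.sum_add_distrib, hess]
    ring
  have e3 : lap G (fun z => h z + u z) y = lap G h y + lap G u y := by
    simp only [lap, e2, mul_add, Finset.sum_add_distrib]
  have e4 : gradInner G f (fun z => h z + u z) y = gradInner G f h y + gradInner G f u y := by
    simp only [gradInner, grad, e1, mul_add, Finset.sum_add_distrib]
  have e5 : ∀ S : Fin n → Fin n → ℝ, contract G S (fun i j => hess G (fun z => h z + u z) i j y) y =
      contract G S (fun i j => hess G h i j y) y + contract G S (fun i j => hess G u i j y) y := by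
    intro S
    simp only [contract, e2, mul_add, Finset.sum_add_distrib]
  rw [locB, locB, locB, e3, e4, e5]
  ring

end IsMetricOn

theorem locB_eq_zero (hV : IsOpen V) (hh : ∀ z ∈ V, h z = 0)
    (hy : y ∈ V) (lam : ℝ) (f : E n → ℝ) : locB G lam f h y = 0 := by
  have e1 : ∀ z ∈ V, ∀ i, pd i h z = 0 := fun z hz i => by
    rw [pd_congr hV hz hh, pd_const]
  have e2 : ∀ i j, hess G h i j y = 0 := by
    intro i j
    rw [hess, pd_congr hV hy (fun z hz => e1 z hz j), pd_const]
    simp [e1 y hy]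
  simp [locB, lap, gradInner, grad, contract, e2, e1 y hy, hh y hy]

theorem fluxField_eq_zero (hV : IsOpen V) (hh : ∀ z ∈ V, h z = 0)
    (hy : y ∈ V) (lam : ℝ) (f : E n → ℝ) (i : Fin n) : fluxField G lam f h i y = 0 := by
  have e1 : ∀ i, pd i h y = 0 := fun i => by rw [pd_congr hV hy hh, pd_const]
  simp [fluxField, hessGrad, grad, e1, hh y hy]

theorem IsPullback.locB_eq (hP : IsPullback Φ G' V G U) (hf : ContDiffOn ℝ ∞ f U)
    (hff : ∀ z ∈ V, f' z = f (Φ z)) (hh : ContDiffOn ℝ ∞ h U)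
    (hhh : ∀ z ∈ V, h' z = h (Φ z)) (hy : y ∈ V) (lam : ℝ) :
    locB G' lam f' h' y = locB G lam f h (Φ y) := by
  rw [locB, locB, hP.lap_eq hf hff hy, hP.lap_eq hh hhh hy,
    hP.contract_eq hy (hP.hess_eq hf hff hy) (hP.hess_eq hh hhh hy), hP.locJ_eq hy, gradInner,
    hP.sum_pd_mul_eq hf hff hy (hP.grad_eq hh hhh hy), hP.locQ_eq hy, hP.locSigmaTwo_eq hy,
    hff y hy, hhh y hy, gradInner]

/-! ### The divergence theorem in coordinates -/

/-- Jacobi's formula for the derivative of a determinant. -/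
theorem pd_det {A : E n → Matrix (Fin n) (Fin n) ℝ}
    (hA : ∀ i j, DifferentiableAt ℝ (fun z => A z i j) y) (m : Fin n) :
    pd m (fun z => (A z).det) y =
      ∑ i, ∑ k, (A y).adjugate i k * pd m (fun z => A z k i) y := by
  have h1 : HasFDerivAt (fun z => (A z).det) (∑ σ : Equiv.Perm (Fin n),
      ((Equiv.Perm.sign σ : ℤ) : ℝ) • ∑ i, (∏ j ∈ Finset.univ.erase i, A y (σ j) j) •
        fderiv ℝ (fun z => A z (σ i) i) y) y := by
    simp only [Matrix.det_apply']
    refine HasFDerivAt.fun_sum fun σ _ => HasFDerivAt.const_mul ?_ _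
    exact HasFDerivAt.finsetProd fun i _ => (hA (σ i) i).hasFDerivAt
  have h2 : ∀ i, ∑ k, (A y).adjugate i k * pd m (fun z => A z k i) y =
      ∑ σ : Equiv.Perm (Fin n), ((Equiv.Perm.sign σ : ℤ) : ℝ) *
        ((∏ j ∈ Finset.univ.erase i, A y (σ j) j) * pd m (fun z => A z (σ i) i) y) := by
    intro i
    -- By Cramer's rule the sum over `k` is the determinant with column `i` replaced by its
    -- derivative, which the Leibniz formula then expands.
    have := congrFun (Matrix.cramer_eq_adjugate_mulVec (A y) fun k => pd m (fun z => A z k i) y) i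
    simp only [Matrix.mulVec, dotProduct] at this
    rw [← this, Matrix.cramer_apply, Matrix.det_apply']
    refine Finset.sum_congr rfl fun σ _ => ?_
    rw [← Finset.mul_prod_erase _ _ (Finset.mem_univ i), Matrix.updateCol_self, mul_comm (pd m _ y)]
    congr 2
    refine Finset.prod_congr rfl fun j hj => ?_
    rw [Matrix.updateCol_ne (Finset.ne_of_mem_erase hj)]
  rw [Finset.sum_congr rfl fun i _ => h2 i, Finset.sum_comm, pd, h1.fderiv]
  simp [pd, Finset.mul_sum]

namespace IsMetricOn

theorem sqrt_det_smooth (hG : IsMetricOn G U) :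
    ContDiffOn ℝ ∞ (fun z => Real.sqrt (G z).det) U :=
  (contDiffOn_det hG.smooth).sqrt fun _ hz => (hG.det_pos hz).ne'

/-- In the trace two of the three derivatives in the Christoffel symbol cancel by the symmetry of
the inverse metric. -/
theorem sum_christoffel (hG : IsMetricOn G U) (hy : y ∈ U) (j : Fin n) :
    ∑ i, christoffel G i i j y =
      (1 / 2) * ∑ i, ∑ k, (G y)⁻¹ i k * pd j (fun z => G z k i) y := by
  have hs : ∀ a b c, pd a (fun z => G z b c) y = pd a (fun z => G z c b) y :=
    fun a b c => pd_congr hG.isOpen hy (fun z hz => hG.symm hz b c) a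
  have h1 : ∑ i, ∑ k, (G y)⁻¹ i k * pd i (fun z => G z j k) y =
      ∑ i, ∑ k, (G y)⁻¹ i k * pd k (fun z => G z i j) y := by
    rw [Finset.sum_comm]
    refine Finset.sum_congr rfl fun i _ => Finset.sum_congr rfl fun k _ => ?_
    rw [hG.inv_symm hy, hs]
  simp only [christoffel, ← Finset.mul_sum, mul_add, mul_sub, Finset.sum_add_distrib,
    Finset.sum_sub_distrib, h1, fun i k => hs j i k]
  ring

theorem pd_sqrt_det (hG : IsMetricOn G U) (hy : y ∈ U) (j : Fin n) :
    pd j (fun z => Real.sqrt (G z).det) y =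
      Real.sqrt (G y).det * ∑ i, christoffel G i i j y := by
  have hd := fun i k => differentiableAt_of_contDiffOn hG.isOpen (hG.smooth i k) hy
  have hdet := differentiableAt_of_contDiffOn hG.isOpen (contDiffOn_det hG.smooth) hy
  have hpos := hG.det_pos hy
  have h1 := pd_det hd j
  have h2 : (G y).adjugate = (G y).det • (G y)⁻¹ := by
    rw [Matrix.inv_def, smul_smul, Ring.inverse_eq_inv', mul_inv_cancel₀ hpos.ne', one_smul]
  rw [h2] at h1
  simp only [Matrix.smul_apply, smul_eq_mul, mul_assoc, ← Finset.mul_sum] at h1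
  rw [hG.sum_christoffel hy]
  rw [pd] at h1 ⊢
  rw [(hdet.hasFDerivAt.sqrt hpos.ne').fderiv, smul_apply, h1, smul_eq_mul]
  have hsq : Real.sqrt (G y).det ≠ 0 := (Real.sqrt_pos.2 hpos).ne'
  have hsq2 := Real.mul_self_sqrt hpos.le
  field_simp
  rw [pow_two, hsq2]

/-- Since ∂_j √det G = √det G · Γ^i_{ij}, the weighted divergence is the Euclidean divergence of
√det G · X. This reduces the divergence theorem to integrals of partial derivatives on ℝⁿ. -/
theorem sqrt_det_mul_divg (hG : IsMetricOn G U) (hX : ∀ i, ContDiffOn ℝ ∞ (X i) U) (hy : y ∈ U) :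
    Real.sqrt (G y).det * divg G X y =
      ∑ i, pd i (fun z => Real.sqrt (G z).det * X i z) y := by
  simp only [fun i => pd_mul hG.isOpen hG.sqrt_det_smooth (hX i) hy i, hG.pd_sqrt_det hy,
    Finset.sum_add_distrib, divg, mul_add, Finset.mul_sum, Finset.sum_mul]
  rw [add_comm]
  congr 1
  rw [Finset.sum_comm]
  refine Finset.sum_congr rfl fun i _ => Finset.sum_congr rfl fun j _ => ?_
  ring

end IsMetricOn

/-- Extension by zero is smooth at points outside `U` because they have a neighbourhood missing the
closed set `K`. -/
theorem contDiff_indicator {w : E n → ℝ} (hU : IsOpen U) (hK : IsClosed K) (hKU : K ⊆ U)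
    (hw : ContDiffOn ℝ ∞ w U) (hw0 : ∀ z ∈ U \ K, w z = 0) : ContDiff ℝ ∞ (U.indicator w) := by
  rw [contDiff_iff_contDiffAt]
  intro z
  by_cases hz : z ∈ U
  · refine (hw.contDiffAt (hU.mem_nhds hz)).congr_of_eventuallyEq ?_
    filter_upwards [hU.mem_nhds hz] with x hx using Set.indicator_of_mem hx w
  · have : U.indicator w =ᶠ[nhds z] fun _ => 0 := by
      filter_upwards [hK.isOpen_compl.mem_nhds fun h => hz (hKU h)] with x hx
      by_cases hxU : x ∈ U
      · rw [Set.indicator_of_mem hxU, hw0 x ⟨hxU, hx⟩]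
      · exact Set.indicator_of_notMem hxU w
    exact contDiffAt_const.congr_of_eventuallyEq this

theorem hasCompactSupport_indicator {w : E n → ℝ} (hK : IsCompact K)
    (hw0 : ∀ z ∈ U \ K, w z = 0) : HasCompactSupport (U.indicator w) := by
  refine HasCompactSupport.intro hK fun z hz => ?_
  by_cases hzU : z ∈ U
  · rw [Set.indicator_of_mem hzU, hw0 z ⟨hzU, hz⟩]
  · exact Set.indicator_of_notMem hzU w

theorem integral_pd_eq_zero {w : E n → ℝ} (hw : ContDiff ℝ ∞ w) (hc : HasCompactSupport w)
    (i : Fin n) : Integrable (pd i w) ∧ ∫ z, pd i w z = 0 := by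
  have hcd : Continuous fun z => fderiv ℝ w z (stdVec i) :=
    (hw.continuous_fderiv (by simp)).clm_apply continuous_const
  have hi : Integrable fun z => fderiv ℝ w z (stdVec i) :=
    hcd.integrable_of_hasCompactSupport (hc.fderiv_apply (𝕜 := ℝ) _)
  refine ⟨hi, ?_⟩
  -- Integration by parts against the constant function 1.
  have := integral_mul_fderiv_eq_neg_fderiv_mul_of_integrable (μ := (volume : Measure (E n)))
    (f := fun _ => (1 : ℝ)) (g := w) (v := stdVec i) (by simp) (by simpa using hi)
    (by simpa using hw.continuous.integrable_of_hasCompactSupport hc) (by simp)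
    (fun x _ => hw.differentiable (by simp) x)
  simpa [pd] using this

/-- The divergence theorem in coordinates, for compactly supported vector fields. -/
theorem IsMetricOn.integral_divg (hG : IsMetricOn G U) (hK : IsCompact K) (hKU : K ⊆ U)
    (hX : ∀ i, ContDiffOn ℝ ∞ (X i) U) (hX0 : ∀ i, ∀ z ∈ U \ K, X i z = 0) :
    ∫ z in U, Real.sqrt (G z).det * divg G X z = 0 := by
  have hw := fun i => hG.sqrt_det_smooth.mul (hX i)
  have hw0 : ∀ i, ∀ z ∈ U \ K, Real.sqrt (G z).det * X i z = 0 := fun i z hz => by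
    rw [hX0 i z hz, mul_zero]
  have key := fun i => integral_pd_eq_zero
    (contDiff_indicator hG.isOpen hK.isClosed hKU (hw i) (hw0 i))
    (hasCompactSupport_indicator hK (hw0 i)) i
  have h1 : ∀ i, ∀ z ∈ U, pd i (fun z => Real.sqrt (G z).det * X i z) z =
      pd i (U.indicator fun z => Real.sqrt (G z).det * X i z) z := fun i z hz =>
    pd_congr hG.isOpen hz (h := U.indicator fun z => Real.sqrt (G z).det * X i z)
      (fun x hx => (Set.indicator_of_mem hx _).symm) i
  rw [setIntegral_congr_fun (g := fun z => ∑ i, pd i (U.indicator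
    fun z => Real.sqrt (G z).det * X i z) z) hG.isOpen.measurableSet]
  · rw [integral_finsetSum _ fun i _ => (key i).1.integrableOn]
    refine Finset.sum_eq_zero fun i _ => ?_
    -- The extended field vanishes near each point outside `U`, hence so does its derivative, and
    -- the integral may be taken over all of ℝⁿ.
    rw [setIntegral_eq_integral_of_forall_compl_eq_zero, (key i).2]
    intro z hz
    have hz' : z ∈ Kᶜ := fun h => hz (hKU h)
    rw [pd_congr hK.isClosed.isOpen_compl hz' (h := fun _ => 0), pd_const]
    intro x hx
    by_cases hxU : x ∈ U
    · rw [Set.indicator_of_mem hxU, hw0 i x ⟨hxU, hx⟩]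
    · exact Set.indicator_of_notMem hxU _
  · intro z hz
    simp only [hG.sqrt_det_mul_divg hX hz]
    exact Finset.sum_congr rfl fun i _ => h1 i z hz

/-- Every term of the flux contains `h` or its gradient, so compact support of `h` alone suffices
and `f` is unrestricted. -/
theorem IsMetricOn.integral_locH_mul_sub (hG : IsMetricOn G U) (hn : 2 < n) (hK : IsCompact K)
    (hKU : K ⊆ U) (hf : ContDiffOn ℝ ∞ f U) (hh : ContDiffOn ℝ ∞ h U)
    (hh0 : ∀ z ∈ U \ K, h z = 0) (lam : ℝ) :
    ∫ z in U, Real.sqrt (G z).det * (locH G lam f z * h z - locB G lam f h z) = 0 := by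
  have hV : IsOpen (U \ K) := hG.isOpen.sdiff hK.isClosed
  rw [← hG.integral_divg hK hKU (hG.fluxField_smooth hf hh lam)
    fun i z hz => fluxField_eq_zero hV hh0 hz lam f i]
  refine setIntegral_congr_fun hG.isOpen.measurableSet fun z hz => ?_
  simp only [hG.locH_mul_eq hn hf hh lam hz, add_sub_cancel_left]

end

section

variable {n : ℕ} {M : Type*} [TopologicalSpace M] [ChartedSpace (E n) M]

/-! ### The metric in charts -/

/-- The coordinate change from the chart at `c'` to the chart at `c`. -/
def coordChange (c' c : M) (y : E n) : E n :=
  extChartAt (𝓡 n) c ((extChartAt (𝓡 n) c').symm y)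

/-- The domain of the coordinate change from the chart at `c'` to the chart at `c`. -/
def coordDomain (c' c : M) : Set (E n) :=
  (extChartAt (𝓡 n) c').target ∩ (extChartAt (𝓡 n) c').symm ⁻¹' (extChartAt (𝓡 n) c).source

theorem isOpen_coordDomain (c' c : M) : IsOpen (coordDomain (n := n) c' c) :=
  (continuousOn_extChartAt_symm c').isOpen_inter_preimage (isOpen_extChartAt_target c')
    (isOpen_extChartAt_source c)

variable [IsManifold (𝓡 n) ∞ M] (g : SmoothMetric n M)

theorem mdifferentiableAt_chart_symm (c : M) {y : E n} (hy : y ∈ (extChartAt (𝓡 n) c).target) :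
    MDifferentiableAt 𝓘(ℝ, E n) (𝓡 n) (extChartAt (𝓡 n) c).symm y :=
  ((contMDiffOn_extChartAt_symm (n := ∞) c).contMDiffAt
    ((isOpen_extChartAt_target c).mem_nhds hy)).mdifferentiableAt (by simp)

/-- The coordinate field is the image of a constant section under the tangent map of the inverse
chart. -/
theorem contMDiffOn_coordVec (c : M) (i : Fin n) :
    ContMDiffOn 𝓘(ℝ, E n) (𝓡 n).tangent ∞
      (fun y => (⟨(extChartAt (𝓡 n) c).symm y, coordVec c i y⟩ : TangentBundle (𝓡 n) M))
      (extChartAt (𝓡 n) c).target := by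
  have ho := isOpen_extChartAt_target (I := 𝓡 n) c
  have h1 := (contMDiffOn_extChartAt_symm (I := 𝓡 n) (n := ∞) c).contMDiffOn_tangentMapWithin
    (m := ∞) (by simp) ho.uniqueMDiffOn
  have h2 : ContMDiff 𝓘(ℝ, E n) (𝓘(ℝ, E n)).tangent ∞
      (fun y => (⟨y, stdVec i⟩ : TangentBundle 𝓘(ℝ, E n) (E n))) :=
    contMDiff_vectorSpace_iff_contDiff.2 contDiff_const
  refine (h1.comp h2.contMDiffOn (s := (extChartAt (𝓡 n) c).target) fun y hy => hy).congr ?_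
  intro y hy
  simp only [Function.comp, tangentMapWithin, coordVec]
  rw [mfderivWithin_of_isOpen ho hy]

theorem metricInChart_smooth (c : M) (i j : Fin n) :
    ContDiffOn ℝ ∞ (fun y => metricInChart g c y i j) (extChartAt (𝓡 n) c).target := by
  rw [← contMDiffOn_iff_contDiffOn]
  have hg : ContMDiffOn 𝓘(ℝ, E n) ((𝓡 n).prod 𝓘(ℝ, E n →L[ℝ] E n →L[ℝ] ℝ)) ∞
      (fun y => Bundle.TotalSpace.mk' (E n →L[ℝ] E n →L[ℝ] ℝ)
        (E := fun x : M => TangentSpace (𝓡 n) x →L[ℝ] TangentSpace (𝓡 n) x →L[ℝ] ℝ)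
        ((extChartAt (𝓡 n) c).symm y) (g.inner ((extChartAt (𝓡 n) c).symm y)))
      (extChartAt (𝓡 n) c).target :=
    g.contMDiff.comp_contMDiffOn (contMDiffOn_extChartAt_symm c)
  have h1 : ContMDiffOn 𝓘(ℝ, E n) ((𝓡 n).prod 𝓘(ℝ, ℝ)) ∞
      (fun y => Bundle.TotalSpace.mk' ℝ (E := Bundle.Trivial M ℝ) ((extChartAt (𝓡 n) c).symm y)
        (g.inner ((extChartAt (𝓡 n) c).symm y) (coordVec c i y) (coordVec c j y)))
      (extChartAt (𝓡 n) c).target :=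
    ContMDiffOn.clm_bundle_apply₂ (F₁ := E n) (F₂ := E n) hg (contMDiffOn_coordVec c i)
      (contMDiffOn_coordVec c j)
  intro y hy
  have h2 := h1 y hy
  simp only [Bundle.contMDiffWithinAt_totalSpace] at h2
  exact h2.2

theorem mfderiv_chart_symm_injective (c : M) {y : E n} (hy : y ∈ (extChartAt (𝓡 n) c).target) :
    Function.Injective (mfderiv 𝓘(ℝ, E n) (𝓡 n) (extChartAt (𝓡 n) c).symm y) := by
  have : IsManifold (𝓡 n) 1 M := IsManifold.of_le (n := ∞) (by simp)
  have h := isInvertible_mfderivWithin_extChartAt_symm (I := 𝓡 n) hy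
  rw [modelWithCornersSelf_coe, Set.range_id, mfderivWithin_univ] at h
  exact h.injective

theorem metricForm_metricInChart (c : M) (y u v : E n) :
    metricForm (metricInChart g c) y u v = g.inner ((extChartAt (𝓡 n) c).symm y)
      (mfderiv 𝓘(ℝ, E n) (𝓡 n) (extChartAt (𝓡 n) c).symm y u)
      (mfderiv 𝓘(ℝ, E n) (𝓡 n) (extChartAt (𝓡 n) c).symm y v) := by
  let L : E n →L[ℝ] E n := mfderiv 𝓘(ℝ, E n) (𝓡 n) (extChartAt (𝓡 n) c).symm y
  let B : E n →L[ℝ] E n →L[ℝ] ℝ := g.inner ((extChartAt (𝓡 n) c).symm y)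
  have h := bilinear_expand (B := fun u v => B (L u) (L v))
    (fun v => ⟨by simp, by simp⟩) (fun v => ⟨by simp, by simp⟩) u v
  change _ = B (L u) (L v)
  rw [h, metricForm_apply]
  refine Finset.sum_congr rfl fun i _ => Finset.sum_congr rfl fun j _ => ?_
  change metricInChart g c y i j * _ = u i * metricInChart g c y i j * v j
  ring

theorem isMetricOn_metricInChart (c : M) :
    IsMetricOn (metricInChart g c) (extChartAt (𝓡 n) c).target where
  isOpen := isOpen_extChartAt_target c
  smooth := metricInChart_smooth g c
  posDef := fun y hy => by
    refine Matrix.PosDef.of_dotProduct_mulVec_pos ?_ fun x hx => ?_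
    · ext i j
      simp only [Matrix.conjTranspose_apply, star_trivial, metricInChart, Matrix.of_apply]
      exact g.symm _ _ _
    · have h1 : (star x) ⬝ᵥ (metricInChart g c y *ᵥ x) =
          metricForm (metricInChart g c) y (WithLp.toLp 2 x) (WithLp.toLp 2 x) := by
        rw [metricForm_apply]
        simp only [dotProduct, Matrix.mulVec, Finset.mul_sum, Pi.star_apply, star_trivial]
        refine Finset.sum_congr rfl fun i _ => Finset.sum_congr rfl fun j _ => ?_
        ring
      rw [h1, metricForm_metricInChart]
      refine g.pos _ _ fun h0 => hx ?_
      have := mfderiv_chart_symm_injective c hy (h0.trans (map_zero _).symm)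
      exact (WithLp.toLp_eq_zero 2).1 this

theorem IsMetricOn.mono {G : E n → Matrix (Fin n) (Fin n) ℝ} {U V : Set (E n)}
    (hG : IsMetricOn G U) (hV : IsOpen V) (hVU : V ⊆ U) : IsMetricOn G V :=
  ⟨hV, fun i j => (hG.smooth i j).mono hVU, fun y hy => hG.posDef y (hVU hy)⟩

theorem coordChange_smooth (c' c : M) :
    ContDiffOn ℝ ∞ (coordChange (n := n) c' c) (coordDomain c' c) := by
  rw [← contMDiffOn_iff_contDiffOn]
  refine (contMDiffOn_extChartAt (I := 𝓡 n) (n := ∞) (x := c)).comp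
    ((contMDiffOn_extChartAt_symm c').mono Set.inter_subset_left) fun y hy => ?_
  have := hy.2
  rwa [Set.mem_preimage, extChartAt_source] at this

/-- Chain rule for the inverse chart at `c'`, which near `y` is the inverse chart at `c` composed
with the coordinate change. -/
theorem mfderiv_chart_symm_eq (c' c : M) {y : E n} (hy : y ∈ coordDomain (n := n) c' c) (u : E n) :
    (mfderiv 𝓘(ℝ, E n) (𝓡 n) (extChartAt (𝓡 n) c').symm y u : E n) =
      (mfderiv 𝓘(ℝ, E n) (𝓡 n) (extChartAt (𝓡 n) c).symm (coordChange c' c y)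
        (fderiv ℝ (coordChange c' c) y u) : E n) := by
  have h1 : (extChartAt (𝓡 n) c').symm =ᶠ[nhds y]
      (extChartAt (𝓡 n) c).symm ∘ coordChange (n := n) c' c := by
    filter_upwards [(isOpen_coordDomain c' c).mem_nhds hy] with z hz
    exact ((extChartAt (𝓡 n) c).left_inv hz.2).symm
  have ht : coordChange c' c y ∈ (extChartAt (𝓡 n) c).target :=
    (extChartAt (𝓡 n) c).map_source hy.2
  have hd : MDifferentiableAt 𝓘(ℝ, E n) 𝓘(ℝ, E n) (coordChange (n := n) c' c) y :=
    (differentiableAt_of_contDiffOn (isOpen_coordDomain c' c) (coordChange_smooth c' c)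
      hy).mdifferentiableAt
  have h2 := mfderiv_comp y (mdifferentiableAt_chart_symm c ht) hd
  rw [mfderiv_eq_fderiv] at h2
  have h3 := h1.mfderiv_eq (I := 𝓘(ℝ, E n)) (I' := 𝓡 n)
  have h4 := h3.trans h2
  exact congrArg (fun L : E n →L[ℝ] E n => L u) h4

/-- Both matrices represent the same inner product on one tangent space. Through this statement all
the pullback laws become statements of independence of the chart. -/
theorem isPullback_coordChange (c' c : M) :
    IsPullback (coordChange c' c) (metricInChart g c') (coordDomain c' c) (metricInChart g c)
      (extChartAt (𝓡 n) c).target where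
  source := (isMetricOn_metricInChart g c').mono (isOpen_coordDomain c' c) Set.inter_subset_left
  target := isMetricOn_metricInChart g c
  smooth := coordChange_smooth c' c
  mapsTo := fun y hy => (extChartAt (𝓡 n) c).map_source hy.2
  entry := fun y hy i j => by
    -- The two base points are equal but not definitionally so; regarding tangent vectors as
    -- elements of `E n` lets the equality be substituted.
    have key : ∀ (p q : M) (_ : p = q) (u v u' v' : E n) (_ : u = u') (_ : v = v'),
        g.inner p u v = g.inner q u' v' := by
      rintro p q rfl u v u' v' rfl rfl
      rfl
    rw [metricForm_metricInChart]
    refine (metricForm_stdVec (G := metricInChart g c') i j).symm.trans ?_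
    rw [metricForm_metricInChart]
    exact key _ _ ((extChartAt (𝓡 n) c).left_inv hy.2).symm _ _ _ _
      (mfderiv_chart_symm_eq c' c hy _) (mfderiv_chart_symm_eq c' c hy _)

end

section

variable {n : ℕ} {M : Type*} [TopologicalSpace M] [ChartedSpace (E n) M]

/-! ### The volume measure -/

theorem det_fderiv_eq_det_jac (Φ : E n → E n) (y : E n) :
    (fderiv ℝ Φ y).det = (jac Φ y).det := by
  rw [ContinuousLinearMap.det, ← LinearMap.det_toMatrix (EuclideanSpace.basisFun (Fin n) ℝ).toBasis]
  congr 1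

/-- The square root of the determinant transforms as a density, by exactly the Jacobian factor of
the change of variables formula. -/
theorem IsPullback.sqrt_det_eq {Φ : E n → E n} {G G' : E n → Matrix (Fin n) (Fin n) ℝ}
    {U V : Set (E n)} (hP : IsPullback Φ G' V G U) {y : E n} (hy : y ∈ V) :
    Real.sqrt (G' y).det = |(fderiv ℝ Φ y).det| * Real.sqrt (G (Φ y)).det := by
  rw [hP.matrix_eq hy, Matrix.det_mul, Matrix.det_mul, Matrix.det_transpose,
    det_fderiv_eq_det_jac, ← Real.sqrt_sq_eq_abs, ← Real.sqrt_mul (sq_nonneg _)]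
  congr 1
  ring

theorem coordChange_mem (c' c : M) {y : E n} (hy : y ∈ coordDomain c' c) :
    coordChange c' c y ∈ coordDomain c c' := by
  refine ⟨(extChartAt (𝓡 n) c).map_source hy.2, ?_⟩
  rw [Set.mem_preimage, coordChange, (extChartAt (𝓡 n) c).left_inv hy.2]
  exact (extChartAt (𝓡 n) c').map_target hy.1

theorem coordChange_coordChange (c' c : M) {y : E n} (hy : y ∈ coordDomain c' c) :
    coordChange c c' (coordChange c' c y) = y := by
  rw [coordChange, coordChange, (extChartAt (𝓡 n) c).left_inv hy.2,
    (extChartAt (𝓡 n) c').right_inv hy.1]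

theorem symm_coordChange (c' c : M) {y : E n} (hy : y ∈ coordDomain c' c) :
    (extChartAt (𝓡 n) c).symm (coordChange c' c y) = (extChartAt (𝓡 n) c').symm y :=
  (extChartAt (𝓡 n) c).left_inv hy.2

variable [MeasurableSpace M] [BorelSpace M]

theorem measurableSet_chart_preimage (c : M) {s : Set M} (hs : MeasurableSet s) :
    MeasurableSet ((extChartAt (𝓡 n) c).symm ⁻¹' s ∩ (extChartAt (𝓡 n) c).target) := by
  have hm : Measurable ((extChartAt (𝓡 n) c).target.domRestrict (extChartAt (𝓡 n) c).symm) :=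
    (continuousOn_iff_continuous_domRestrict.1 (continuousOn_extChartAt_symm c)).measurable
  have h1 := (isOpen_extChartAt_target (I := 𝓡 n) c).measurableSet.subtype_image (hm hs)
  rwa [Set.domRestrict_eq, Set.preimage_comp, Subtype.image_preimage_val, Set.inter_comm] at h1

variable [IsManifold (𝓡 n) ∞ M] (g : SmoothMetric n M)

theorem aemeasurable_chart_symm (c : M) : AEMeasurable (extChartAt (𝓡 n) c).symm
    (((volume : Measure (E n)).restrict (extChartAt (𝓡 n) c).target).withDensity
    (fun y => ENNReal.ofReal (Real.sqrt (metricInChart g c y).det))) :=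
  ((continuousOn_extChartAt_symm c).aemeasurable
    (isOpen_extChartAt_target c).measurableSet).mono_ac (withDensity_absolutelyContinuous _ _)

theorem chartVolume_apply (c : M) {s : Set M} (hs : MeasurableSet s) :
    chartVolume g c s = ∫⁻ y in (extChartAt (𝓡 n) c).symm ⁻¹' s ∩ (extChartAt (𝓡 n) c).target,
      ENNReal.ofReal (Real.sqrt (metricInChart g c y).det) := by
  rw [chartVolume, Measure.map_apply_of_aemeasurable (aemeasurable_chart_symm g c) hs,
    withDensity_apply', Measure.restrict_restrict' (isOpen_extChartAt_target c).measurableSet]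

theorem chartVolume_inter_source (c : M) {s : Set M} (hs : MeasurableSet s) :
    chartVolume g c (s ∩ (extChartAt (𝓡 n) c).source) = chartVolume g c s := by
  rw [chartVolume_apply g c (hs.inter (isOpen_extChartAt_source c).measurableSet),
    chartVolume_apply g c hs]
  congr 2
  ext y
  simp only [Set.mem_inter_iff, Set.mem_preimage]
  exact ⟨fun h => ⟨h.1.1, h.2⟩, fun h => ⟨⟨h.1, (extChartAt (𝓡 n) c).map_target h.2⟩, h.2⟩⟩

/-- The coordinate volumes of two charts agree on the overlap. -/
theorem chartVolume_eq_of_subset (c c' : M) {s : Set M} (hs : MeasurableSet s)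
    (hc : s ⊆ (extChartAt (𝓡 n) c).source) (hc' : s ⊆ (extChartAt (𝓡 n) c').source) :
    chartVolume g c s = chartVolume g c' s := by
  have hP := isPullback_coordChange g c' c
  have hA : ∀ {c c' : M}, s ⊆ (extChartAt (𝓡 n) c').source →
      (extChartAt (𝓡 n) c).symm ⁻¹' s ∩ (extChartAt (𝓡 n) c).target ⊆ coordDomain c c' :=
    fun h y hy => ⟨hy.2, h hy.1⟩
  have himg : coordChange c' c '' ((extChartAt (𝓡 n) c').symm ⁻¹' s ∩ (extChartAt (𝓡 n) c').target) =
      (extChartAt (𝓡 n) c).symm ⁻¹' s ∩ (extChartAt (𝓡 n) c).target := by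
    ext z
    constructor
    · rintro ⟨y, hy, rfl⟩
      have hy' := hA hc hy
      refine ⟨?_, (coordChange_mem c' c hy').1⟩
      rw [Set.mem_preimage, symm_coordChange c' c hy']
      exact hy.1
    · intro hz
      have hz' := hA hc' hz
      refine ⟨coordChange c c' z, ⟨?_, (coordChange_mem c c' hz').1⟩,
        coordChange_coordChange c c' hz'⟩
      rw [Set.mem_preimage, symm_coordChange c c' hz']
      exact hz.1
  rw [chartVolume_apply g c hs, chartVolume_apply g c' hs, ← himg,
    lintegral_image_eq_lintegral_abs_det_fderiv_mul volume (measurableSet_chart_preimage c' hs)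
      (fun y hy => (hP.differentiableAt (hA hc hy)).hasFDerivAt.hasFDerivWithinAt)
      (fun y hy z hz h => by
        rw [← coordChange_coordChange c' c (hA hc hy), h, coordChange_coordChange c' c (hA hc hz)])]
  refine setLIntegral_congr_fun (measurableSet_chart_preimage c' hs) fun y hy => ?_
  simp only [hP.sqrt_det_eq (hA hc hy)]
  rw [ENNReal.ofReal_mul (abs_nonneg _)]

/-- The Riemannian volume restricts to the coordinate volume on each chart domain. -/
theorem vol_apply_of_subset (c : M) {s : Set M} (hs : MeasurableSet s)
    (hc : s ⊆ (extChartAt (𝓡 n) c).source) : vol g s = chartVolume g c s := by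
  have hsrc := (isOpen_extChartAt_source (I := 𝓡 n) c).measurableSet
  have hle : ∀ c, chartVolume g c ≤ vol g := fun c => le_iSup (chartVolume g) c
  refine le_antisymm ?_ (hle c s)
  -- As `vol g` is a least upper bound, it is enough that the right side dominates each chart
  -- volume. Off the source of `c` the first summand does so; on the source the volumes of the two
  -- charts agree.
  have h1 : vol g ≤ (vol g).restrict ((extChartAt (𝓡 n) c).source)ᶜ + chartVolume g c := by
    refine iSup_le fun c' => Measure.le_iff.2 fun u hu => ?_
    rw [Measure.add_apply, Measure.restrict_apply hu, ← measure_inter_add_sdiff u hsrc, add_comm,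
      ← Set.sdiff_eq]
    refine add_le_add (hle c' _) ?_
    rw [← chartVolume_inter_source g c' (hu.inter hsrc), chartVolume_eq_of_subset g c' c
      ((hu.inter hsrc).inter (isOpen_extChartAt_source c').measurableSet) Set.inter_subset_right
      (fun x hx => hx.1.2)]
    exact measure_mono fun x hx => hx.1.1
  refine (h1 s).trans_eq ?_
  rw [Measure.add_apply, Measure.restrict_apply hs, ← Set.sdiff_eq, Set.sdiff_eq_empty.2 hc]
  simp

theorem vol_restrict_source (c : M) :
    (vol g).restrict (extChartAt (𝓡 n) c).source = chartVolume g c := by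
  have hsrc := (isOpen_extChartAt_source (I := 𝓡 n) c).measurableSet
  ext s hs
  rw [Measure.restrict_apply hs, vol_apply_of_subset g c (hs.inter hsrc) Set.inter_subset_right,
    chartVolume_inter_source g c hs]

theorem integral_vol_of_support_subset (c : M) {F : M → ℝ} (hF : Continuous F)
    (hc : ∀ x, x ∉ (extChartAt (𝓡 n) c).source → F x = 0) :
    ∫ x, F x ∂(vol g) = ∫ y in (extChartAt (𝓡 n) c).target,
      Real.sqrt (metricInChart g c y).det * F ((extChartAt (𝓡 n) c).symm y) := by
  rw [← setIntegral_eq_integral_of_forall_compl_eq_zero hc, vol_restrict_source, chartVolume,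
    integral_map (aemeasurable_chart_symm g c) hF.aestronglyMeasurable,
    integral_withDensity_eq_integral_toReal_smul₀]
  · simp only [ENNReal.toReal_ofReal (Real.sqrt_nonneg _), smul_eq_mul]
  · exact ((isMetricOn_metricInChart g c).sqrt_det_smooth.continuousOn.aemeasurable
      (isOpen_extChartAt_target c).measurableSet).ennreal_ofReal
  · exact Filter.Eventually.of_forall fun y => ENNReal.ofReal_lt_top

/-- The density is continuous, hence integrable on a small closed ball inside the chart target. On
compact `M` this makes every continuous function integrable. -/
instance isLocallyFiniteMeasure_vol : IsLocallyFiniteMeasure (vol g) where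
  finiteAtNhds x := by
    have ho := isOpen_extChartAt_target (I := 𝓡 n) x
    obtain ⟨r, hr, hrs⟩ := Metric.nhds_basis_closedBall.mem_iff.1
      (ho.mem_nhds (mem_extChartAt_target x))
    let N : Set M := (extChartAt (𝓡 n) x).source ∩
      extChartAt (𝓡 n) x ⁻¹' Metric.ball (extChartAt (𝓡 n) x x) r
    have hN : IsOpen N := (continuousOn_extChartAt x).isOpen_inter_preimage
      (isOpen_extChartAt_source x) Metric.isOpen_ball
    have hxN : x ∈ N := ⟨mem_extChartAt_source x, Metric.mem_ball_self hr⟩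
    refine ⟨N, hN.mem_nhds hxN, ?_⟩
    rw [vol_apply_of_subset g x hN.measurableSet Set.inter_subset_left,
      chartVolume_apply g x hN.measurableSet]
    have hsub : (extChartAt (𝓡 n) x).symm ⁻¹' N ∩ (extChartAt (𝓡 n) x).target ⊆
        Metric.closedBall (extChartAt (𝓡 n) x x) r := by
      intro y hy
      have h1 : extChartAt (𝓡 n) x ((extChartAt (𝓡 n) x).symm y) ∈
        Metric.ball (extChartAt (𝓡 n) x x) r := hy.1.2
      rw [(extChartAt (𝓡 n) x).right_inv hy.2] at h1
      exact Metric.ball_subset_closedBall h1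
    have hi : IntegrableOn (fun y => Real.sqrt (metricInChart g x y).det)
        (Metric.closedBall (extChartAt (𝓡 n) x x) r) :=
      ((isMetricOn_metricInChart g x).sqrt_det_smooth.continuousOn.mono
        hrs).integrableOn_compact (isCompact_closedBall _ _)
    exact (lintegral_mono_set hsub).trans_lt hi.lintegral_lt_top

end

section

variable {n : ℕ} {M : Type*} [TopologicalSpace M] [ChartedSpace (E n) M]

/-! ### Integration on the manifold -/

theorem mem_coordDomain {c x : M} (hx : x ∈ (extChartAt (𝓡 n) c).source) :
    extChartAt (𝓡 n) x x ∈ coordDomain (n := n) x c := by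
  refine ⟨mem_extChartAt_target x, ?_⟩
  rwa [Set.mem_preimage, extChartAt_to_inv]

theorem coordChange_self (c x : M) :
    coordChange x c (extChartAt (𝓡 n) x x) = extChartAt (𝓡 n) c x := by
  rw [coordChange, extChartAt_to_inv]

/-- `H`, `formB` and the curvature functions are evaluated in a chart that varies with the point;
continuity is visible only after rewriting them in one fixed chart. -/
theorem continuous_of_charts {F : M → ℝ} (hF : ∀ c : M, ∃ F' : E n → ℝ,
    ContDiffOn ℝ ∞ F' (extChartAt (𝓡 n) c).target ∧
      ∀ x ∈ (extChartAt (𝓡 n) c).source, F x = F' (extChartAt (𝓡 n) c x)) : Continuous F := by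
  rw [continuous_iff_continuousAt]
  intro x
  obtain ⟨F', hF', h⟩ := hF x
  have h1 : ContinuousOn (fun z => F' (extChartAt (𝓡 n) x z)) (extChartAt (𝓡 n) x).source :=
    hF'.continuousOn.comp (continuousOn_extChartAt x) fun z hz =>
      (extChartAt (𝓡 n) x).map_source hz
  exact (h1.congr h).continuousAt ((isOpen_extChartAt_source x).mem_nhds (mem_extChartAt_source x))

variable [IsManifold (𝓡 n) ∞ M] (g : SmoothMetric n M) {φ ψ : M → ℝ} (lam : ℝ)

theorem contDiffOn_comp_chart_symm (hφ : ContMDiff (𝓡 n) 𝓘(ℝ, ℝ) ∞ φ) (c : M) :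
    ContDiffOn ℝ ∞ (φ ∘ (extChartAt (𝓡 n) c).symm) (extChartAt (𝓡 n) c).target := by
  rw [← contMDiffOn_iff_contDiffOn]
  exact hφ.comp_contMDiffOn (contMDiffOn_extChartAt_symm c)

/-- The symmetric bilinear form representing `∫ Hφ · ψ`, as a function on `M`. -/
def formB (φ ψ : M → ℝ) (x : M) : ℝ :=
  locB (metricInChart g x) lam (φ ∘ (extChartAt (𝓡 n) x).symm) (ψ ∘ (extChartAt (𝓡 n) x).symm)
    (extChartAt (𝓡 n) x x)

theorem Q_eq {c x : M} (hx : x ∈ (extChartAt (𝓡 n) c).source) :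
    Q g x = locQ (metricInChart g c) (extChartAt (𝓡 n) c x) := by
  rw [Q, (isPullback_coordChange g x c).locQ_eq (mem_coordDomain hx), coordChange_self]

theorem sigmaTwo_eq {c x : M} (hx : x ∈ (extChartAt (𝓡 n) c).source) :
    sigmaTwo g x = locSigmaTwo (metricInChart g c) (extChartAt (𝓡 n) c x) := by
  rw [sigmaTwo, (isPullback_coordChange g x c).locSigmaTwo_eq (mem_coordDomain hx),
    coordChange_self]

theorem H_eq (hφ : ContMDiff (𝓡 n) 𝓘(ℝ, ℝ) ∞ φ) {c x : M}
    (hx : x ∈ (extChartAt (𝓡 n) c).source) :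
    H g lam φ x = locH (metricInChart g c) lam (φ ∘ (extChartAt (𝓡 n) c).symm)
      (extChartAt (𝓡 n) c x) := by
  rw [H, (isPullback_coordChange g x c).locH_eq (f' := φ ∘ (extChartAt (𝓡 n) x).symm)
    (contDiffOn_comp_chart_symm hφ c)
    (fun z hz => congrArg φ (symm_coordChange x c hz).symm) (mem_coordDomain hx), coordChange_self]

theorem formB_eq (hφ : ContMDiff (𝓡 n) 𝓘(ℝ, ℝ) ∞ φ) (hψ : ContMDiff (𝓡 n) 𝓘(ℝ, ℝ) ∞ ψ) {c x : M}
    (hx : x ∈ (extChartAt (𝓡 n) c).source) :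
    formB g lam φ ψ x = locB (metricInChart g c) lam (φ ∘ (extChartAt (𝓡 n) c).symm)
      (ψ ∘ (extChartAt (𝓡 n) c).symm) (extChartAt (𝓡 n) c x) := by
  rw [formB, (isPullback_coordChange g x c).locB_eq (f' := φ ∘ (extChartAt (𝓡 n) x).symm)
    (h' := ψ ∘ (extChartAt (𝓡 n) x).symm) (contDiffOn_comp_chart_symm hφ c)
    (fun z hz => congrArg φ (symm_coordChange x c hz).symm) (contDiffOn_comp_chart_symm hψ c)
    (fun z hz => congrArg ψ (symm_coordChange x c hz).symm) (mem_coordDomain hx), coordChange_self]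

theorem continuous_H (hφ : ContMDiff (𝓡 n) 𝓘(ℝ, ℝ) ∞ φ) : Continuous (H g lam φ) :=
  continuous_of_charts fun c => ⟨_, (isMetricOn_metricInChart g c).locH_smooth
    (contDiffOn_comp_chart_symm hφ c) lam, fun _ hx => H_eq g lam hφ hx⟩

theorem continuous_formB (hφ : ContMDiff (𝓡 n) 𝓘(ℝ, ℝ) ∞ φ)
    (hψ : ContMDiff (𝓡 n) 𝓘(ℝ, ℝ) ∞ ψ) : Continuous (formB g lam φ ψ) :=
  continuous_of_charts fun c => ⟨_, (isMetricOn_metricInChart g c).locB_smooth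
    (contDiffOn_comp_chart_symm hφ c) (contDiffOn_comp_chart_symm hψ c) lam,
    fun _ hx => formB_eq g lam hφ hψ hx⟩

theorem continuous_Q_sub : Continuous fun x => Q g x - lam * sigmaTwo g x :=
  continuous_of_charts fun c => ⟨_, (isMetricOn_metricInChart g c).locQ_smooth.sub
    (contDiffOn_const.mul (isMetricOn_metricInChart g c).locSigmaTwo_smooth),
    fun x hx => by rw [Q_eq g hx, sigmaTwo_eq g hx]⟩

theorem formB_comm (φ ψ : M → ℝ) (x : M) : formB g lam φ ψ x = formB g lam ψ φ x :=
  (isMetricOn_metricInChart g x).locB_comm (mem_extChartAt_target x) lam _ _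

theorem formB_add {ψ' : M → ℝ} (hψ : ContMDiff (𝓡 n) 𝓘(ℝ, ℝ) ∞ ψ)
    (hψ' : ContMDiff (𝓡 n) 𝓘(ℝ, ℝ) ∞ ψ') (φ : M → ℝ) (x : M) :
    formB g lam φ (fun z => ψ z + ψ' z) x = formB g lam φ ψ x + formB g lam φ ψ' x :=
  (isMetricOn_metricInChart g x).locB_add (contDiffOn_comp_chart_symm hψ x)
    (contDiffOn_comp_chart_symm hψ' x) (mem_extChartAt_target x) lam _

theorem formB_eq_zero {x : M} (hx : x ∉ tsupport ψ) : formB g lam φ ψ x = 0 := by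
  refine locB_eq_zero (V := (extChartAt (𝓡 n) x).target ∩
    (extChartAt (𝓡 n) x).symm ⁻¹' (tsupport ψ)ᶜ) ?_ (fun z hz => ?_) ⟨mem_extChartAt_target x, ?_⟩
    lam _
  · exact (continuousOn_extChartAt_symm x).isOpen_inter_preimage (isOpen_extChartAt_target x)
      (isClosed_tsupport ψ).isOpen_compl
  · exact image_eq_zero_of_notMem_tsupport (f := ψ) hz.2
  · rwa [Set.mem_preimage, extChartAt_to_inv]

variable [CompactSpace M] [MeasurableSpace M] [BorelSpace M]

theorem integrable_vol {F : M → ℝ} (hF : Continuous F) : Integrable F (vol g) :=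
  hF.integrable_of_hasCompactSupport (HasCompactSupport.of_compactSpace F)

/-- The single-chart case: the integrand vanishes outside the chart domain, and the coordinate
divergence theorem applies to the compact image of the support of `ψ`. -/
theorem integral_H_mul_sub_of_support_subset (hn : 2 < n) (hφ : ContMDiff (𝓡 n) 𝓘(ℝ, ℝ) ∞ φ)
    (hψ : ContMDiff (𝓡 n) 𝓘(ℝ, ℝ) ∞ ψ) (c : M) (hc : tsupport ψ ⊆ (extChartAt (𝓡 n) c).source) :
    ∫ x, (H g lam φ x * ψ x - formB g lam φ ψ x) ∂(vol g) = 0 := by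
  have hF : Continuous fun x => H g lam φ x * ψ x - formB g lam φ ψ x :=
    ((continuous_H g lam hφ).mul hψ.continuous).sub (continuous_formB g lam hφ hψ)
  have hK : IsCompact (extChartAt (𝓡 n) c '' tsupport ψ) :=
    (isClosed_tsupport ψ).isCompact.image_of_continuousOn ((continuousOn_extChartAt c).mono hc)
  have hKU : extChartAt (𝓡 n) c '' tsupport ψ ⊆ (extChartAt (𝓡 n) c).target := by
    rintro _ ⟨x, hx, rfl⟩
    exact (extChartAt (𝓡 n) c).map_source (hc hx)
  rw [integral_vol_of_support_subset g c hF fun x hx => ?_]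
  · rw [← (isMetricOn_metricInChart g c).integral_locH_mul_sub hn hK hKU
      (contDiffOn_comp_chart_symm hφ c) (contDiffOn_comp_chart_symm hψ c) (fun z hz => ?_) lam]
    · refine setIntegral_congr_fun (isOpen_extChartAt_target c).measurableSet fun y hy => ?_
      have hs := (extChartAt (𝓡 n) c).map_target hy
      simp only [H_eq g lam hφ hs, formB_eq g lam hφ hψ hs, (extChartAt (𝓡 n) c).right_inv hy,
        Function.comp_apply]
    · refine image_eq_zero_of_notMem_tsupport (f := ψ) fun h => hz.2 ⟨_, h, ?_⟩
      exact (extChartAt (𝓡 n) c).right_inv hz.1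
  · have hx' : x ∉ tsupport ψ := fun h => hx (hc h)
    rw [formB_eq_zero g lam hx', image_eq_zero_of_notMem_tsupport hx', mul_zero, sub_zero]

/-- Both sides are additive in `ψ`, so `ψ` may be split by a finite partition of unity subordinate
to chart domains, while `φ` stays intact. -/
theorem integral_H_mul_eq [T2Space M] (hn : 2 < n) (hφ : ContMDiff (𝓡 n) 𝓘(ℝ, ℝ) ∞ φ)
    (hψ : ContMDiff (𝓡 n) 𝓘(ℝ, ℝ) ∞ ψ) :
    ∫ x, H g lam φ x * ψ x ∂(vol g) = ∫ x, formB g lam φ ψ x ∂(vol g) := by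
  obtain ⟨t, -, ht⟩ := isCompact_univ.elim_nhds_subcover
    (fun x : M => (extChartAt (𝓡 n) x).source)
    fun x _ => (isOpen_extChartAt_source x).mem_nhds (mem_extChartAt_source x)
  obtain ⟨ρ, hρ⟩ := SmoothPartitionOfUnity.exists_isSubordinate (𝓡 n) isClosed_univ
    (fun x : t => (extChartAt (𝓡 n) (x : M)).source) (fun x => isOpen_extChartAt_source _)
    (fun x hx => by simpa using ht hx)
  have hρψ : ∀ a, ContMDiff (𝓡 n) 𝓘(ℝ, ℝ) ∞ fun x => ρ a x * ψ x :=
    fun a => (ρ a).contMDiff.mul hψ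
  -- Induction over partial sums; smoothness of the partial sum is carried along because additivity
  -- and integrability both require it.
  have hsum : ∀ s : Finset t, ContMDiff (𝓡 n) 𝓘(ℝ, ℝ) ∞ (fun x => ∑ a ∈ s, ρ a x * ψ x) ∧
      ∫ x, (H g lam φ x * (∑ a ∈ s, ρ a x * ψ x)
        - formB g lam φ (fun x => ∑ a ∈ s, ρ a x * ψ x) x) ∂(vol g) = 0 := by
    classical
    intro s
    induction s using Finset.induction_on with
    | empty =>
      refine ⟨by simpa using contMDiff_const, ?_⟩
      have h0 : ∀ x, formB g lam φ (fun _ => 0) x = 0 := fun x => formB_eq_zero g lam (by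
        simp [tsupport])
      simp [h0]
    | insert a s ha ih =>
      have hi : ∀ {χ : M → ℝ}, ContMDiff (𝓡 n) 𝓘(ℝ, ℝ) ∞ χ →
          Integrable (fun x => H g lam φ x * χ x - formB g lam φ χ x) (vol g) := fun hχ =>
        integrable_vol g (((continuous_H g lam hφ).mul hχ.continuous).sub
          (continuous_formB g lam hφ hχ))
      simp only [Finset.sum_insert ha]
      refine ⟨(hρψ a).add ih.1, ?_⟩
      have h1 := integral_H_mul_sub_of_support_subset g lam hn hφ (hρψ a) a
        ((tsupport_mul_subset_left).trans (hρ a))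
      have h2 := integral_add (hi (hρψ a)) (hi ih.1)
      rw [h1, ih.2, add_zero] at h2
      rw [← h2]
      refine integral_congr_ae (Filter.Eventually.of_forall fun x => ?_)
      simp only [formB_add g lam (hρψ a) ih.1 φ x]
      ring
  have hψ1 : (fun x => ∑ a, ρ a x * ψ x) = ψ := by
    ext x
    have := ρ.sum_eq_one (Set.mem_univ x)
    rw [finsum_eq_sum_of_fintype] at this
    rw [← Finset.sum_mul, this, one_mul]
  have h := (hsum Finset.univ).2
  simp only [fun x => congrFun hψ1 x] at h
  have h' := integral_sub (integrable_vol g ((continuous_H g lam hφ).mul hψ.continuous))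
    (integrable_vol g (continuous_formB g lam hφ hψ))
  exact sub_eq_zero.1 (h'.symm.trans h)

theorem exists_mul_integral_sq_le [T2Space M] (hn : 6 ≤ n) (hlam₀ : 0 ≤ lam) (hlam₄ : lam ≤ 4)
    (hQ : ∀ x : M, 0 < Q g x - lam * sigmaTwo g x) (hJ : ∀ x : M, 0 < J g x) :
    ∃ c : ℝ, 0 < c ∧ ∀ φ : M → ℝ, ContMDiff (𝓡 n) 𝓘(ℝ, ℝ) ∞ φ →
      c * ∫ x, φ x ^ 2 ∂(vol g) ≤ ∫ x, H g lam φ x * φ x ∂(vol g) := by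
  have hn' : (6 : ℝ) ≤ n := by exact_mod_cast hn
  -- The minimum over the compact manifold is attained, hence positive; on the empty manifold any
  -- positive number serves.
  obtain ⟨m, hm, hmQ⟩ : ∃ m : ℝ, 0 < m ∧ ∀ x : M, m ≤ Q g x - lam * sigmaTwo g x := by
    rcases isEmpty_or_nonempty M with hM | hM
    · exact ⟨1, one_pos, fun x => hM.elim x⟩
    · obtain ⟨x₀, -, hx₀⟩ := isCompact_univ.exists_isMinOn Set.univ_nonempty
        (continuous_Q_sub g lam).continuousOn
      exact ⟨_, hQ x₀, fun x => hx₀ (Set.mem_univ x)⟩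
  refine ⟨((n : ℝ) - 4) / 2 * m, mul_pos (by linarith) hm, fun φ hφ => ?_⟩
  rw [integral_H_mul_eq g lam (by omega) hφ hφ, ← integral_const_mul]
  refine integral_mono (integrable_vol g (continuous_const.mul (hφ.continuous.pow 2)))
    (integrable_vol g (continuous_formB g lam hφ hφ)) fun x => ?_
  refine le_trans ?_ ((isMetricOn_metricInChart g x).le_locB_self hn hlam₀ hlam₄
    (contDiffOn_comp_chart_symm hφ x) (mem_extChartAt_target x) (hJ x))
  simp only [Function.comp_apply, extChartAt_to_inv]
  exact mul_le_mul_of_nonneg_right (mul_le_mul_of_nonneg_left (hmQ x) (by linarith)) (sq_nonneg _)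

end

end PaneitzH

end

theorem lemma2p1 (n : ℕ) (hn : 6 ≤ n)
    (M : Type*) [TopologicalSpace M] [T2Space M] [CompactSpace M]
    [ChartedSpace (EuclideanSpace ℝ (Fin n)) M] [IsManifold (𝓡 n) ∞ M]
    [MeasurableSpace M] [BorelSpace M]
    (g : PaneitzH.SmoothMetric n M)
    (lam : ℝ) (hlam₀ : 0 ≤ lam) (hlam₄ : lam ≤ 4)
    (hQ : ∀ x : M, 0 < PaneitzH.Q g x - lam * PaneitzH.sigmaTwo g x)
    (hJ : ∀ x : M, 0 < PaneitzH.J g x) :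
    PaneitzH.IsPositiveDefinite g (PaneitzH.H g lam) := by
  refine ⟨fun φ ψ hφ hψ => ?_,
    PaneitzH.exists_mul_integral_sq_le g lam hn hlam₀ hlam₄ hQ hJ⟩
  -- Puts `H` on the left in both integrals, so that each becomes the integral of `formB`, with the
  -- arguments in opposite order.
  simp only [mul_comm (φ _)]
  rw [PaneitzH.integral_H_mul_eq g lam (by omega) hφ hψ,
    PaneitzH.integral_H_mul_eq g lam (by omega) hψ hφ]
  exact integral_congr_ae (Filter.Eventually.of_forall fun x => PaneitzH.formB_comm g lam φ ψ x)
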